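/- **Proposition 4.4.** Let $M=G/K$ be an irreducible symmetric space of non-compact type, where the connected Lie group $G$ acts transitively and by isometries on $M$ and $K$ is the isotropy group of a point $o\in M$. Let $\theta$ be the corresponding Cartan involution of the Lie algebra $\mathfrak g$ of $G$, $\mathfrak g=\mathfrak k\oplus\mathfrak p$ its Cartan decomposition, $\mathfrak a$ a maximal abelian subspace of $\mathfrak p$, and $\mathfrak n=\bigoplus_{\lambda\in\Sigma^+}\mathfrak g_\lambda$ the sum of the restricted root spaces of the roots that are positive for some positivity criterion on $\mathfrak a^*$. Let $AN$ be the connected Lie subgroup of $G$ with Lie algebra $\mathfrak a\oplus\mathfrak n$, endowed with the left-invariant metric $\langle\cdot,\cdot\rangle$ obtained by pulling back the metric of $M$ along $AN\to M$, $h\mapsto h\cdot o$. Let $H\in\mathfrak a$ be a unit vector with respect to $\langle\cdot,\cdot\rangle$, and let $S$ be the connected Lie subgroup of $AN$ with Lie algebra $$\mathfrak s=(\mathfrak a\ominus\mathbb R H)\oplus\mathfrak n,$$ where $\ominus$ denotes orthogonal complement, endowed with the metric induced from $AN$. Then $S$ is a solvsoliton, that is, $S$ is solvable and its Ricci operator (the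 $(1,1)$-Ricci tensor, regarded as an endomorphism of $\mathfrak s$) has the form $\mathrm{Ric}=c\,\mathrm{Id}+D$ for some $c\in\mathbb R$ and some derivation $D$ of $\mathfrak s$. More precisely, there is a real number $k<0$ such that $\mathrm{Ric}^{AN}=k\,\mathrm{Id}$ (the Einstein constant of $M\cong AN$), the restriction of $\mathrm{ad}(H)$ to $\mathfrak s$ is a derivation of $\mathfrak s$, and $$\mathrm{Ric}=k\,\mathrm{Id}+\operatorname{tr}(\mathrm{ad}(H))\,\mathrm{ad}(H)\quad\text{on }\mathfrak s,$$ where the trace is that of the restriction of $\mathrm{ad}(H)$ to $\mathfrak s$. -/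

import Mathlib

open scoped Manifold ContDiff
open Bundle

noncomputable section

/-! Manifolds are smooth, finite-dimensional and without boundary: they are modelled on a
finite-dimensional real normed space `E` through `𝓘(ℝ, E)`. -/

instance completeSpaceOfFiniteDimensionalReal {E : Type*} [NormedAddCommGroup E]
    [NormedSpace ℝ E] [FiniteDimensional ℝ E] : CompleteSpace E :=
  FiniteDimensional.complete ℝ E

/-- Smooth Lie groups have the regularity under which Mathlib constructs their Lie algebra. -/
instance lieGroupMinSmoothness {E : Type*} [NormedAddCommGroup E] [NormedSpace ℝ E]
    {G : Type*} [TopologicalSpace G] [ChartedSpace E G] [Group G] [h : LieGroup 𝓘(ℝ, E) ∞ G] :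
    LieGroup 𝓘(ℝ, E) (minSmoothness ℝ 3) G := by
  rw [minSmoothness_of_isRCLikeNormedField]
  infer_instance

/-! ### Levi-Civita connection and curvature -/

section Riemannian

variable {E : Type*} [NormedAddCommGroup E] [NormedSpace ℝ E] [FiniteDimensional ℝ E]
  {M : Type*} [TopologicalSpace M] [ChartedSpace E M] [IsManifold 𝓘(ℝ, E) ∞ M]

/-- `nabla` is the Levi-Civita connection of the Riemannian manifold `M`: it is torsion free, and
`v⟨Y, Z⟩ = ⟨∇_v Y, Z⟩ + ⟨Y, ∇_v Z⟩`. (Mathlib writes `nabla Y x v` for `∇_v Y`, `v ∈ T_x M`.) -/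
structure IsLeviCivita [RiemannianBundle (fun x : M ↦ TangentSpace 𝓘(ℝ, E) x)]
    (nabla : CovariantDerivative 𝓘(ℝ, E) E (TangentSpace 𝓘(ℝ, E) : M → Type _)) : Prop where
  torsion_eq_zero : nabla.torsion = 0
  metric (Y Z : Π x : M, TangentSpace 𝓘(ℝ, E) x) (x : M) (v : TangentSpace 𝓘(ℝ, E) x) :
    MDiffAt (fun y ↦ (Y y : TangentBundle 𝓘(ℝ, E) M)) x →
    MDiffAt (fun y ↦ (Z y : TangentBundle 𝓘(ℝ, E) M)) x →
    mfderiv 𝓘(ℝ, E) 𝓘(ℝ, ℝ) (fun y ↦ inner ℝ (Y y) (Z y)) x v =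
      inner ℝ (nabla Y x v) (Z x) + inner ℝ (Y x) (nabla Z x v)

/-- The curvature `R(X, Y) Z = ∇_X ∇_Y Z - ∇_Y ∇_X Z - ∇_[X, Y] Z` on vector fields. -/
def curvature (nabla : CovariantDerivative 𝓘(ℝ, E) E (TangentSpace 𝓘(ℝ, E) : M → Type _))
    (X Y Z : Π x : M, TangentSpace 𝓘(ℝ, E) x) (x : M) : TangentSpace 𝓘(ℝ, E) x :=
  nabla (fun y ↦ nabla Z y (Y y)) x (X x) - nabla (fun y ↦ nabla Z y (X y)) x (Y x)
    - nabla Z x (VectorField.mlieBracket 𝓘(ℝ, E) X Y x)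

end Riemannian

/-- The derivative of `f` preserves the Riemannian metrics. -/
def IsIsometricImmersion
    {E : Type*} [NormedAddCommGroup E] [NormedSpace ℝ E]
    {M : Type*} [TopologicalSpace M] [ChartedSpace E M]
    [RiemannianBundle (fun x : M ↦ TangentSpace 𝓘(ℝ, E) x)]
    {E' : Type*} [NormedAddCommGroup E'] [NormedSpace ℝ E']
    {M' : Type*} [TopologicalSpace M'] [ChartedSpace E' M']
    [RiemannianBundle (fun x : M' ↦ TangentSpace 𝓘(ℝ, E') x)]
    (f : M → M') : Prop :=
  ContMDiff 𝓘(ℝ, E) 𝓘(ℝ, E') ∞ f ∧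
    ∀ (x : M) (v w : TangentSpace 𝓘(ℝ, E) x),
      inner ℝ (mfderiv 𝓘(ℝ, E) 𝓘(ℝ, E') f x v) (mfderiv 𝓘(ℝ, E) 𝓘(ℝ, E') f x w) = inner ℝ v w

/-! ### Lie groups with a left-invariant metric -/

section LieGroups

variable {E : Type*} [NormedAddCommGroup E] [NormedSpace ℝ E] [FiniteDimensional ℝ E]
  {S : Type*} [TopologicalSpace S] [ChartedSpace E S] [Group S] [LieGroup 𝓘(ℝ, E) ∞ S]

instance finiteDimensionalTangentSpace (x : S) : FiniteDimensional ℝ (TangentSpace 𝓘(ℝ, E) x) :=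
  inferInstanceAs (FiniteDimensional ℝ E)

/-- The `(1,1)`-Ricci tensor at the identity, `Ric v = ∑ᵢ R(v, eᵢ) eᵢ` for an orthonormal basis
`eᵢ` of the Lie algebra. As curvature is tensorial, it may be computed from the left-invariant
extensions of these tangent vectors. -/
def ricciOperator [RiemannianBundle (fun x : S ↦ TangentSpace 𝓘(ℝ, E) x)]
    (nabla : CovariantDerivative 𝓘(ℝ, E) E (TangentSpace 𝓘(ℝ, E) : S → Type _))
    (v : GroupLieAlgebra 𝓘(ℝ, E) S) : GroupLieAlgebra 𝓘(ℝ, E) S :=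
  ∑ i, curvature nabla (mulInvariantVectorField v)
    (mulInvariantVectorField (stdOrthonormalBasis ℝ (TangentSpace 𝓘(ℝ, E) (1 : S)) i))
    (mulInvariantVectorField (stdOrthonormalBasis ℝ (TangentSpace 𝓘(ℝ, E) (1 : S)) i)) 1

/-- `S` is solvable and its left-invariant metric is an algebraic Ricci soliton: `Ric = c Id + D`
for a real number `c` and a derivation `D` of the Lie algebra of `S`. A connected Lie group is
solvable if its Lie algebra is. -/
def IsSolvsoliton [RiemannianBundle (fun x : S ↦ TangentSpace 𝓘(ℝ, E) x)]
    (nabla : CovariantDerivative 𝓘(ℝ, E) E (TangentSpace 𝓘(ℝ, E) : S → Type _)) : Prop :=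
  LieAlgebra.IsSolvable (GroupLieAlgebra 𝓘(ℝ, E) S) ∧
    ∃ (c : ℝ) (D : LieDerivation ℝ (GroupLieAlgebra 𝓘(ℝ, E) S) (GroupLieAlgebra 𝓘(ℝ, E) S)),
      ∀ v : GroupLieAlgebra 𝓘(ℝ, E) S, ricciOperator nabla v = c • v + D v

variable {E' : Type*} [NormedAddCommGroup E'] [NormedSpace ℝ E']
  {G : Type*} [TopologicalSpace G] [ChartedSpace E' G] [Group G]

/-- The differential at the identity `Lie S → Lie G` of a homomorphism `S → G`
(recall that `ι 1 = 1`). -/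
def lieMap (ι : S →* G) : GroupLieAlgebra 𝓘(ℝ, E) S →ₗ[ℝ] GroupLieAlgebra 𝓘(ℝ, E') G :=
  (mfderiv 𝓘(ℝ, E) 𝓘(ℝ, E') ι 1 : TangentSpace 𝓘(ℝ, E) (1 : S) →ₗ[ℝ] TangentSpace 𝓘(ℝ, E') (ι 1))

/-- Through `ι`, the Lie group `S` is the connected (immersed) Lie subgroup of `G` with Lie
algebra `𝔥`. -/
structure IsConnectedLieSubgroup (ι : S →* G)
    (𝔥 : Submodule ℝ (GroupLieAlgebra 𝓘(ℝ, E') G)) : Prop where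
  connected : ConnectedSpace S
  contMDiff : ContMDiff 𝓘(ℝ, E) 𝓘(ℝ, E') ∞ ι
  injective : Function.Injective ι
  injective_lieMap : Function.Injective (lieMap (E := E) (E' := E') ι)
  range_lieMap : LinearMap.range (lieMap (E := E) (E' := E') ι) = 𝔥

end LieGroups

/-! ### Symmetric spaces of non-compact type -/

section SymmetricSpace

variable {E : Type*} [NormedAddCommGroup E] [NormedSpace ℝ E] [FiniteDimensional ℝ E]
  {G : Type*} [TopologicalSpace G] [ChartedSpace E G] [Group G] [LieGroup 𝓘(ℝ, E) ∞ G]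
  {F : Type*} [NormedAddCommGroup F] [NormedSpace ℝ F]
  {M : Type*} [TopologicalSpace M] [ChartedSpace F M] [MulAction G M]

/-- The differential at the identity of the orbit map `G → M`, `g ↦ g • o`. -/
def orbitMapDeriv (o : M) :
    TangentSpace 𝓘(ℝ, E) (1 : G) →ₗ[ℝ] TangentSpace 𝓘(ℝ, F) ((1 : G) • o) :=
  (mfderiv 𝓘(ℝ, E) 𝓘(ℝ, F) (fun g : G ↦ g • o) 1 :
    TangentSpace 𝓘(ℝ, E) (1 : G) →L[ℝ] TangentSpace 𝓘(ℝ, F) ((1 : G) • o))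

/-- The `-1`-eigenspace `𝔭` of the involution `θ`. -/
def pSpace (θ : GroupLieAlgebra 𝓘(ℝ, E) G →ₗ⁅ℝ⁆ GroupLieAlgebra 𝓘(ℝ, E) G) :
    Submodule ℝ (GroupLieAlgebra 𝓘(ℝ, E) G) where
  carrier := {X | θ X = -X}
  add_mem' {X Y} hX hY := by
    have hX' : θ X = -X := hX
    have hY' : θ Y = -Y := hY
    change θ (X + Y) = -(X + Y)
    rw [map_add, hX', hY', neg_add]
  zero_mem' := by
    change θ 0 = -0
    simp
  smul_mem' c X hX := by
    have hX' : θ X = -X := hX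
    change θ (c • X) = -(c • X)
    rw [map_smul, hX', smul_neg]

/-- The Riemannian manifold `M = G / K` is an irreducible symmetric space of non-compact type, where
`K` is the isotropy group of `o`: the connected Lie group `G` acts transitively and by isometries on
`M`, and `θ` is a Cartan involution of the Lie algebra `𝔤` of `G` (which is thereby semisimple)
whose `+1`-eigenspace is the Lie algebra `𝔨` of `K`, i.e. the kernel of the differential of the
orbit map of `o`. Irreducibility: the isotropy representation of `𝔨` on `𝔭 ≅ T_o M` is
irreducible. -/
structure IsIrreducibleSymmetricSpace [RiemannianBundle (fun x : M ↦ TangentSpace 𝓘(ℝ, F) x)]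
    (o : M) (θ : GroupLieAlgebra 𝓘(ℝ, E) G →ₗ⁅ℝ⁆ GroupLieAlgebra 𝓘(ℝ, E) G) : Prop where
  connected : ConnectedSpace G
  smooth : ContMDiffSMul 𝓘(ℝ, E) 𝓘(ℝ, F) ∞ G M
  transitive : MulAction.IsPretransitive G M
  isometric (g : G) : IsIsometricImmersion (E := F) (E' := F) (fun x : M ↦ g • x)
  involutive (X : GroupLieAlgebra 𝓘(ℝ, E) G) : θ (θ X) = X
  cartan (X : GroupLieAlgebra 𝓘(ℝ, E) G) : X ≠ 0 →
    0 < -killingForm ℝ (GroupLieAlgebra 𝓘(ℝ, E) G) (θ X) X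
  isotropy (X : GroupLieAlgebra 𝓘(ℝ, E) G) : θ X = X ↔ orbitMapDeriv (F := F) o X = 0
  nontrivial : pSpace θ ≠ ⊥
  irreducible (W : Submodule ℝ (GroupLieAlgebra 𝓘(ℝ, E) G)) : W ≤ pSpace θ →
    (∀ X Y : GroupLieAlgebra 𝓘(ℝ, E) G, θ X = X → Y ∈ W → ⁅X, Y⁆ ∈ W) → W = ⊥ ∨ W = pSpace θ

/-- `𝔞` is a maximal abelian subspace of `𝔭`. -/
structure IsMaximalAbelian (θ : GroupLieAlgebra 𝓘(ℝ, E) G →ₗ⁅ℝ⁆ GroupLieAlgebra 𝓘(ℝ, E) G)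
    (𝔞 : Submodule ℝ (GroupLieAlgebra 𝓘(ℝ, E) G)) : Prop where
  le : 𝔞 ≤ pSpace θ
  abelian : ∀ X ∈ 𝔞, ∀ Y ∈ 𝔞, ⁅X, Y⁆ = 0
  maximal : ∀ 𝔟 : Submodule ℝ (GroupLieAlgebra 𝓘(ℝ, E) G), 𝔟 ≤ pSpace θ →
    (∀ X ∈ 𝔟, ∀ Y ∈ 𝔟, ⁅X, Y⁆ = 0) → 𝔞 ≤ 𝔟 → 𝔟 = 𝔞

/-- The restricted root space `𝔤_l = {X | [A, X] = l(A) X for all A ∈ 𝔞}`. -/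
def rootSpace (𝔞 : Submodule ℝ (GroupLieAlgebra 𝓘(ℝ, E) G)) (l : Module.Dual ℝ 𝔞) :
    Submodule ℝ (GroupLieAlgebra 𝓘(ℝ, E) G) where
  carrier := {X | ∀ A : 𝔞, ⁅(A : GroupLieAlgebra 𝓘(ℝ, E) G), X⁆ = l A • X}
  add_mem' hX hY A := by rw [lie_add, hX A, hY A, smul_add]
  zero_mem' A := by simp
  smul_mem' c X hX A := by rw [lie_smul, hX A, smul_comm]

/-- The set of restricted roots. -/
def restrictedRoots (𝔞 : Submodule ℝ (GroupLieAlgebra 𝓘(ℝ, E) G)) : Set (Module.Dual ℝ 𝔞) :=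
  {l | l ≠ 0 ∧ rootSpace 𝔞 l ≠ ⊥}

/-- A positivity criterion on a real vector space: exactly one of `v`, `-v` is positive for every
`v ≠ 0`, and sums and positive multiples of positive vectors are positive. -/
structure IsPositivity {V : Type*} [AddCommGroup V] [Module ℝ V] (P : Set V) : Prop where
  xor : ∀ v : V, v ≠ 0 → Xor (v ∈ P) (-v ∈ P)
  add : ∀ v ∈ P, ∀ w ∈ P, v + w ∈ P
  smul : ∀ v ∈ P, ∀ t : ℝ, 0 < t → t • v ∈ P

/-- The nilpotent part `𝔫` of the Iwasawa decomposition: the sum of the root spaces of the positive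
restricted roots. -/
def nilpotentPart (𝔞 : Submodule ℝ (GroupLieAlgebra 𝓘(ℝ, E) G)) (P : Set (Module.Dual ℝ 𝔞)) :
    Submodule ℝ (GroupLieAlgebra 𝓘(ℝ, E) G) :=
  ⨆ l ∈ restrictedRoots 𝔞 ∩ P, rootSpace 𝔞 l

/-- The inner product on `𝔞` obtained by pulling back the metric of `M` along the orbit map. -/
def orbitInner [RiemannianBundle (fun x : M ↦ TangentSpace 𝓘(ℝ, F) x)] (o : M)
    (X Y : GroupLieAlgebra 𝓘(ℝ, E) G) : ℝ :=
  inner ℝ (orbitMapDeriv (F := F) o X) (orbitMapDeriv (F := F) o Y)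

/-- `𝔞 ⊖ ℝ A`. -/
def orthogonalIn [RiemannianBundle (fun x : M ↦ TangentSpace 𝓘(ℝ, F) x)] (o : M)
    (𝔞 : Submodule ℝ (GroupLieAlgebra 𝓘(ℝ, E) G)) (A : GroupLieAlgebra 𝓘(ℝ, E) G) :
    Submodule ℝ (GroupLieAlgebra 𝓘(ℝ, E) G) where
  carrier := {X | X ∈ 𝔞 ∧ orbitInner (F := F) o X A = 0}
  add_mem' := by
    rintro X Y ⟨hX, hX'⟩ ⟨hY, hY'⟩
    refine ⟨𝔞.add_mem hX hY, ?_⟩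
    unfold orbitInner at *
    rw [map_add, inner_add_left, hX', hY', add_zero]
  zero_mem' := by
    refine ⟨𝔞.zero_mem, ?_⟩
    unfold orbitInner
    rw [map_zero, inner_zero_left]
  smul_mem' := by
    rintro c X ⟨hX, hX'⟩
    refine ⟨𝔞.smul_mem c hX, ?_⟩
    unfold orbitInner at *
    rw [map_smul, real_inner_smul_left, hX', mul_zero]

end SymmetricSpace

end

/-! Everything reduces to algebra on `𝔤`. The metric of `M` pulls back along the orbit map to a form
`Q` on `𝔤` that sees only the `𝔭`-components and is `𝔨`-invariant
(`orbitForm_lie_add_orbitForm_lie`). By irreducibility and Schur's lemma, `Q = c B` on `𝔭`, with `B`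
the Killing form and `c > 0` (`exists_eq_killingForm`).

Simultaneous diagonalization of `ad 𝔞` shows that `𝔞 ⊕ 𝔫` projects onto `𝔭`
(`exists_mem_sup_pPart_eq`), so the Lie algebra of `AN` is isometric to `𝔭`. Read in `𝔭`, its
connection is `∇_x y = [x_𝔨, y_𝔭]`, since this is torsion free and metric (`pPart_connection`). The
curvature is then `-[[x_𝔭, y_𝔭], z_𝔭]`, and a trace computation gives the Ricci form `-B/2`, so that
`k = -1/(2c)` (`ricci_eq`).

The unit normal `H` of `𝔰` has no `𝔨`-component, hence `∇_H = 0` and `∇_x H = -[H, x]`: the second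
fundamental form of `𝔰` is given by `D = ad H`. In the Gauss equation the trace produces `tr(D) D -
D²`, while the missing normal term `R(v, H) H = -D² v` restores `D²`. What remains is `k Id + tr(D)
D` (`ricci_codimension_one`). As `𝔫` is orthogonal to `𝔞` and contains the derived algebra of `𝔞 ⊕
𝔫`, `ad H` preserves `𝔰`.

Solvability comes from filtering `𝔫` by the height of the roots (`isSolvable_of_mem_sup`). The
passage from manifolds to algebra rests on the Koszul formula, which makes covariant derivatives of
left-invariant fields left-invariant, and on `lieMap_lie`. -/

noncomputable section

/-! ### Vector fields as derivations of vector-valued functions. -/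

section DirectionalDerivative

open VectorField Filter Topology Set

variable {E : Type*} [NormedAddCommGroup E] [NormedSpace ℝ E]
  {M : Type*} [TopologicalSpace M] [ChartedSpace E M]
  {F : Type*} [NormedAddCommGroup F] [NormedSpace ℝ F]

/-- The derivative of the vector-valued function `f` along the vector field `V`. -/
def fieldDeriv (f : M → F) (V : Π x : M, TangentSpace 𝓘(ℝ, E) x) (x : M) : F :=
  mfderiv 𝓘(ℝ, E) 𝓘(ℝ, F) f x (V x)

/-- A vector field read in the chart at `x`. -/
def chartField (V : Π x : M, TangentSpace 𝓘(ℝ, E) x) (x : M) : E → E :=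
  mpullbackWithin 𝓘(ℝ, E) 𝓘(ℝ, E) (extChartAt 𝓘(ℝ, E) x).symm V (range 𝓘(ℝ, E))

lemma contDiffAt_comp_extChartAt_symm {f : M → F} {x : M}
    (hf : ContMDiffAt 𝓘(ℝ, E) 𝓘(ℝ, F) 2 f x) :
    ContDiffAt ℝ 2 (f ∘ (extChartAt 𝓘(ℝ, E) x).symm) (extChartAt 𝓘(ℝ, E) x x) := by
  have h := (contMDiffAt_iff.1 hf).2
  have hr : Set.range 𝓘(ℝ, E) = univ := by simp
  rw [extChartAt_model_space_eq_id, hr] at h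
  exact contDiffWithinAt_univ.1 h

variable [IsManifold 𝓘(ℝ, E) ∞ M]

/-- Chain rule: `chartField` applies the inverse of the differential of the inverse chart, and the
two cancel. -/
lemma fderiv_chartField {f : M → F} {x : M} {u : E} (V : Π x : M, TangentSpace 𝓘(ℝ, E) x)
    (hu : u ∈ (extChartAt 𝓘(ℝ, E) x).target)
    (hf : MDifferentiableAt 𝓘(ℝ, E) 𝓘(ℝ, F) f ((extChartAt 𝓘(ℝ, E) x).symm u)) :
    fderiv ℝ (f ∘ (extChartAt 𝓘(ℝ, E) x).symm) u (chartField V x u) =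
      fieldDeriv f V ((extChartAt 𝓘(ℝ, E) x).symm u) := by
  have : IsManifold 𝓘(ℝ, E) 1 M := IsManifold.of_le (n := ∞) (by simp)
  have hinv := isInvertible_mfderivWithin_extChartAt_symm (I := 𝓘(ℝ, E)) hu
  have hψ := mdifferentiableWithinAt_extChartAt_symm (I := 𝓘(ℝ, E)) hu
  rw [← mfderiv_eq_fderiv, ← mfderivWithin_univ]
  have hr : range 𝓘(ℝ, E) = univ := by simp
  unfold chartField fieldDeriv
  rw [mpullbackWithin_apply]
  rw [hr] at hψ hinv ⊢
  erw [mfderiv_comp_mfderivWithin u hf hψ (uniqueMDiffWithinAt_univ 𝓘(ℝ, E))]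
  exact congrArg (mfderiv 𝓘(ℝ, E) 𝓘(ℝ, F) f _) (hinv.self_apply_inverse _)

lemma mfderiv_extChartAt_apply (V : Π x : M, TangentSpace 𝓘(ℝ, E) x) (x : M) :
    mfderiv 𝓘(ℝ, E) 𝓘(ℝ, E) (extChartAt 𝓘(ℝ, E) x) x (V x) =
      chartField V x (extChartAt 𝓘(ℝ, E) x x) := by
  have : IsManifold 𝓘(ℝ, E) 1 M := IsManifold.of_le (n := ∞) (by simp)
  have hx : (extChartAt 𝓘(ℝ, E) x).symm (extChartAt 𝓘(ℝ, E) x x) = x := extChartAt_to_inv x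
  have hd : DifferentiableAt ℝ (extChartAt 𝓘(ℝ, E) x ∘ (extChartAt 𝓘(ℝ, E) x).symm)
      (extChartAt 𝓘(ℝ, E) x x) ∧ fderiv ℝ (extChartAt 𝓘(ℝ, E) x ∘ (extChartAt 𝓘(ℝ, E) x).symm)
      (extChartAt 𝓘(ℝ, E) x x) = .id ℝ E := by
    have h : (extChartAt 𝓘(ℝ, E) x ∘ (extChartAt 𝓘(ℝ, E) x).symm) =ᶠ[𝓝 (extChartAt 𝓘(ℝ, E) x x)]
        id := by
      filter_upwards [extChartAt_target_mem_nhds (I := 𝓘(ℝ, E)) x] with u hu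
      exact (extChartAt 𝓘(ℝ, E) x).right_inv hu
    exact ⟨h.differentiableAt_iff.2 differentiableAt_id, by rw [h.fderiv_eq, fderiv_id]⟩
  have h := fderiv_chartField (f := extChartAt 𝓘(ℝ, E) x) V (mem_extChartAt_target x)
    (by rw [hx]; exact mdifferentiableAt_extChartAt (mem_chart_source E x))
  rw [hd.2] at h
  have h2 := congrArg (fieldDeriv (extChartAt 𝓘(ℝ, E) x) V) hx
  exact (h.trans h2).symm

/-- The manifold bracket is by definition pulled back from the chart, and the differential of the
chart undoes that pullback. -/
lemma mfderiv_extChartAt_mlieBracket (V W : Π x : M, TangentSpace 𝓘(ℝ, E) x) (x : M) :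
    mfderiv 𝓘(ℝ, E) 𝓘(ℝ, E) (extChartAt 𝓘(ℝ, E) x) x (mlieBracket 𝓘(ℝ, E) V W x) =
      lieBracket ℝ (chartField V x) (chartField W x) (extChartAt 𝓘(ℝ, E) x x) := by
  have : IsManifold 𝓘(ℝ, E) 1 M := IsManifold.of_le (n := ∞) (by simp)
  have hinv := isInvertible_mfderiv_extChartAt (mem_extChartAt_source (I := 𝓘(ℝ, E)) x)
  have hr : univ ∩ range 𝓘(ℝ, E) = univ := by simp
  let b : E := lieBracketWithin ℝ (chartField V x) (chartField W x)
    (univ ∩ range 𝓘(ℝ, E)) (extChartAt 𝓘(ℝ, E) x x)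
  refine (hinv.self_apply_inverse (b : TangentSpace 𝓘(ℝ, E) (extChartAt 𝓘(ℝ, E) x x))).trans ?_
  change b = _
  simp only [b, hr, lieBracketWithin_univ]

lemma differentiableAt_chartField {V : Π x : M, TangentSpace 𝓘(ℝ, E) x} {x : M}
    [CompleteSpace E]
    (hV : MDifferentiableAt 𝓘(ℝ, E) 𝓘(ℝ, E).tangent
      (fun y ↦ (V y : TangentBundle 𝓘(ℝ, E) M)) x) :
    DifferentiableAt ℝ (chartField V x) (extChartAt 𝓘(ℝ, E) x x) := by
  have : IsManifold 𝓘(ℝ, E) 2 M := IsManifold.of_le (n := ∞) ENat.LEInfty.out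
  have h := (mdifferentiableWithinAt_univ.2
    hV).differentiableWithinAt_mpullbackWithin_vectorField
  have hr : (extChartAt 𝓘(ℝ, E) x).symm ⁻¹' univ ∩ range 𝓘(ℝ, E) = univ := by simp
  rw [hr] at h
  exact differentiableWithinAt_univ.1 h

/-- The derivative of `f` along `W` is, near `x`, a function of the chart at `x`. -/
lemma fieldDeriv_eventuallyEq {f : M → F} {x : M} (W : Π x : M, TangentSpace 𝓘(ℝ, E) x)
    (hf : ContMDiffAt 𝓘(ℝ, E) 𝓘(ℝ, F) 2 f x) :
    fieldDeriv f W =ᶠ[𝓝 x] (fun u ↦ fderiv ℝ (f ∘ (extChartAt 𝓘(ℝ, E) x).symm) u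
      (chartField W x u)) ∘ extChartAt 𝓘(ℝ, E) x := by
  have : IsManifold 𝓘(ℝ, E) 2 M := IsManifold.of_le (n := ∞) ENat.LEInfty.out
  have h2 : ∀ᶠ y in 𝓝 x, ContMDiffAt 𝓘(ℝ, E) 𝓘(ℝ, F) 2 f y :=
    (contMDiffAt_iff_contMDiffAt_nhds (by simp)).1 hf
  filter_upwards [h2, extChartAt_source_mem_nhds (I := 𝓘(ℝ, E)) x] with y hy hy'
  have hl := (extChartAt 𝓘(ℝ, E) x).left_inv hy'
  have h := fderiv_chartField (f := f) W ((extChartAt 𝓘(ℝ, E) x).map_source hy')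
    (by rw [hl]; exact hy.mdifferentiableAt (by simp))
  rw [hl] at h
  exact h.symm

lemma differentiableAt_fderiv_chartField [CompleteSpace E] {f : M → F} {x : M}
    {W : Π x : M, TangentSpace 𝓘(ℝ, E) x}
    (hf : ContMDiffAt 𝓘(ℝ, E) 𝓘(ℝ, F) 2 f x)
    (hW : MDifferentiableAt 𝓘(ℝ, E) 𝓘(ℝ, E).tangent
      (fun y ↦ (W y : TangentBundle 𝓘(ℝ, E) M)) x) :
    DifferentiableAt ℝ (fun u ↦ fderiv ℝ (f ∘ (extChartAt 𝓘(ℝ, E) x).symm) u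
      (chartField W x u)) (extChartAt 𝓘(ℝ, E) x x) :=
  (((contDiffAt_comp_extChartAt_symm hf).fderiv_right (m := 1)
    (by norm_num)).differentiableAt (by simp)).clm_apply (differentiableAt_chartField hW)

lemma mdifferentiableAt_fieldDeriv [CompleteSpace E] {f : M → F} {x : M}
    {W : Π x : M, TangentSpace 𝓘(ℝ, E) x}
    (hf : ContMDiffAt 𝓘(ℝ, E) 𝓘(ℝ, F) 2 f x)
    (hW : MDifferentiableAt 𝓘(ℝ, E) 𝓘(ℝ, E).tangent
      (fun y ↦ (W y : TangentBundle 𝓘(ℝ, E) M)) x) :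
    MDifferentiableAt 𝓘(ℝ, E) 𝓘(ℝ, F) (fieldDeriv f W) x := by
  have : IsManifold 𝓘(ℝ, E) 1 M := IsManifold.of_le (n := ∞) (by simp)
  exact (((differentiableAt_fderiv_chartField hf hW).mdifferentiableAt).comp x
    (mdifferentiableAt_extChartAt (mem_chart_source E x))).congr_of_eventuallyEq
    (fieldDeriv_eventuallyEq W hf)

/-- The Lie bracket is the commutator of the derivatives of vector-valued functions. -/
theorem fieldDeriv_mlieBracket [CompleteSpace E] {f : M → F} {x : M}
    {V W : Π x : M, TangentSpace 𝓘(ℝ, E) x}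
    (hf : ContMDiffAt 𝓘(ℝ, E) 𝓘(ℝ, F) 2 f x)
    (hV : MDifferentiableAt 𝓘(ℝ, E) 𝓘(ℝ, E).tangent
      (fun y ↦ (V y : TangentBundle 𝓘(ℝ, E) M)) x)
    (hW : MDifferentiableAt 𝓘(ℝ, E) 𝓘(ℝ, E).tangent
      (fun y ↦ (W y : TangentBundle 𝓘(ℝ, E) M)) x) :
    fieldDeriv f (mlieBracket 𝓘(ℝ, E) V W) x =
      fieldDeriv (fieldDeriv f W) V x - fieldDeriv (fieldDeriv f V) W x := by
  have : IsManifold 𝓘(ℝ, E) 1 M := IsManifold.of_le (n := ∞) (by simp)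
  have hφ := mdifferentiableAt_extChartAt (I := 𝓘(ℝ, E)) (mem_chart_source E x)
  have second : ∀ {V W : Π x : M, TangentSpace 𝓘(ℝ, E) x},
      MDifferentiableAt 𝓘(ℝ, E) 𝓘(ℝ, E).tangent
      (fun y ↦ (W y : TangentBundle 𝓘(ℝ, E) M)) x →
      fieldDeriv (fieldDeriv f W) V x =
      fderiv ℝ (fun u ↦ fderiv ℝ (f ∘ (extChartAt 𝓘(ℝ, E) x).symm) u
      (chartField W x u)) (extChartAt 𝓘(ℝ, E) x x) (chartField V x (extChartAt 𝓘(ℝ, E) x x)) := by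
    intro V W hW
    have h1 := (fieldDeriv_eventuallyEq W hf).mfderiv_eq (I := 𝓘(ℝ, E)) (I' := 𝓘(ℝ, F))
    have h2 := mfderiv_comp x (differentiableAt_fderiv_chartField hf hW).mdifferentiableAt hφ
    rw [mfderiv_eq_fderiv] at h2
    rw [← mfderiv_extChartAt_apply]
    exact (DFunLike.congr_fun h1 (V x)).trans (DFunLike.congr_fun h2 (V x))
  have first : ∀ w : TangentSpace 𝓘(ℝ, E) x, mfderiv 𝓘(ℝ, E) 𝓘(ℝ, F) f x w =
      fderiv ℝ (f ∘ (extChartAt 𝓘(ℝ, E) x).symm) (extChartAt 𝓘(ℝ, E) x x)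
        (mfderiv 𝓘(ℝ, E) 𝓘(ℝ, E) (extChartAt 𝓘(ℝ, E) x) x w) := by
    intro w
    have h1 : f =ᶠ[𝓝 x] (f ∘ (extChartAt 𝓘(ℝ, E) x).symm) ∘ extChartAt 𝓘(ℝ, E) x := by
      filter_upwards [extChartAt_source_mem_nhds (I := 𝓘(ℝ, E)) x] with y hy
      exact congrArg f ((extChartAt 𝓘(ℝ, E) x).left_inv hy).symm
    have h2 := mfderiv_comp x ((contDiffAt_comp_extChartAt_symm hf).differentiableAt
      (by simp)).mdifferentiableAt hφ
    rw [mfderiv_eq_fderiv] at h2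
    exact (DFunLike.congr_fun (h1.mfderiv_eq (I := 𝓘(ℝ, E)) (I' := 𝓘(ℝ, F))) w).trans
      (DFunLike.congr_fun h2 w)
  rw [second hV, second hW]
  refine (first _).trans ?_
  rw [mfderiv_extChartAt_mlieBracket]
  have hf' := contDiffAt_comp_extChartAt_symm hf
  have hdf := (hf'.fderiv_right (m := 1) (by norm_num)).differentiableAt (by simp)
  have hsymm : IsSymmSndFDerivAt ℝ (f ∘ (extChartAt 𝓘(ℝ, E) x).symm) (extChartAt 𝓘(ℝ, E) x x) :=
    hf'.isSymmSndFDerivAt (by simp)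
  rw [fderiv_clm_apply hdf (differentiableAt_chartField hV),
    fderiv_clm_apply hdf (differentiableAt_chartField hW), lieBracket_eq]
  simp only [_root_.add_apply, ContinuousLinearMap.comp_apply,
    ContinuousLinearMap.flip_apply, map_sub]
  -- The second-derivative terms cancel by symmetry; the first-order terms form the bracket.
  rw [hsymm.eq]
  abel

end DirectionalDerivative

/-! ### Differentials and metrics read on the model spaces. -/

section TangentDerivative

open VectorField Filter Topology Set

variable {E : Type*} [NormedAddCommGroup E] [NormedSpace ℝ E]
  {M : Type*} [TopologicalSpace M] [ChartedSpace E M]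
  {E' : Type*} [NormedAddCommGroup E'] [NormedSpace ℝ E']
  {M' : Type*} [TopologicalSpace M'] [ChartedSpace E' M']
  {E'' : Type*} [NormedAddCommGroup E''] [NormedSpace ℝ E'']
  {M'' : Type*} [TopologicalSpace M''] [ChartedSpace E'' M'']
  {F : Type*} [NormedAddCommGroup F] [NormedSpace ℝ F]

/-- The derivative of a map between manifolds as a map between the model spaces, so that the base
point may be rewritten. -/
def modelDeriv (f : M → M') (x : M) : E →L[ℝ] E' := mfderiv 𝓘(ℝ, E) 𝓘(ℝ, E') f x

lemma modelDeriv_comp {g : M' → M''} {f : M → M'} {x : M}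
    (hg : MDifferentiableAt 𝓘(ℝ, E') 𝓘(ℝ, E'') g (f x))
    (hf : MDifferentiableAt 𝓘(ℝ, E) 𝓘(ℝ, E') f x) :
    modelDeriv (E := E) (E' := E'') (fun y ↦ g (f y)) x =
      (modelDeriv (E := E') (E' := E'') g (f x)).comp (modelDeriv (E := E) (E' := E') f x) :=
  mfderiv_comp x hg hf

lemma modelDeriv_id (x : M) : modelDeriv (E := E) (E' := E) (fun y : M ↦ y) x = .id ℝ E :=
  mfderiv_id

lemma fieldDeriv_eq_modelDeriv (f : M → F) (V : Π x : M, TangentSpace 𝓘(ℝ, E) x) (x : M) :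
    fieldDeriv f V x = modelDeriv (E := E) (E' := F) f x (V x) := rfl

/-- The metric of a Riemannian manifold as a family of bilinear forms on the model space. -/
def metricAt [h : RiemannianBundle (fun x : M ↦ TangentSpace 𝓘(ℝ, E) x)] (x : M) :
    E →L[ℝ] E →L[ℝ] ℝ :=
  h.g.inner x

lemma metricAt_comm [h : RiemannianBundle (fun x : M ↦ TangentSpace 𝓘(ℝ, E) x)] (x : M)
    (v w : E) : metricAt x v w = metricAt x w v := h.g.symm x v w

lemma metricAt_pos [h : RiemannianBundle (fun x : M ↦ TangentSpace 𝓘(ℝ, E) x)] (x : M)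
    (v : E) (hv : v ≠ 0) : 0 < metricAt x v v := h.g.pos x v hv

lemma IsIsometricImmersion.metricAt_eq
    [RiemannianBundle (fun x : M ↦ TangentSpace 𝓘(ℝ, E) x)]
    [RiemannianBundle (fun x : M' ↦ TangentSpace 𝓘(ℝ, E') x)] {f : M → M'}
    (hf : IsIsometricImmersion (E := E) (E' := E') f) (x : M) (v w : E) :
    metricAt (f x) (modelDeriv (E := E) (E' := E') f x v) (modelDeriv (E := E) (E' := E') f x w) =
      metricAt x v w :=
  hf.2 x v w

end TangentDerivative

/-! ### Left-invariant vector fields. -/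

section LeftInvariant

open VectorField Filter Topology Set

variable {E : Type*} [NormedAddCommGroup E] [NormedSpace ℝ E]
  {S : Type*} [TopologicalSpace S] [ChartedSpace E S] [Group S]
  {E' : Type*} [NormedAddCommGroup E'] [NormedSpace ℝ E']
  {M' : Type*} [TopologicalSpace M'] [ChartedSpace E' M']

lemma mulInvariantVectorField_eq_modelDeriv (v : GroupLieAlgebra 𝓘(ℝ, E) S) (g : S) :
    mulInvariantVectorField v g = modelDeriv (E := E) (E' := E) (fun x ↦ g * x) (1 : S) v := rfl

lemma mulInvariantVectorField_one (v : GroupLieAlgebra 𝓘(ℝ, E) S) :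
    (mulInvariantVectorField v (1 : S) : E) = v := by
  rw [mulInvariantVectorField_eq_modelDeriv]
  simp only [one_mul, modelDeriv_id]
  rfl

variable [LieGroup 𝓘(ℝ, E) ∞ S]

lemma mdifferentiableAt_mul_left' (g h : S) :
    MDifferentiableAt 𝓘(ℝ, E) 𝓘(ℝ, E) (fun x ↦ g * x) h :=
  (contMDiff_mul_left (I := 𝓘(ℝ, E)) (n := ∞) (a := g)).contMDiffAt.mdifferentiableAt (by simp)

/-- A map which intertwines left translation by `g` with `Φ` maps the left-invariant vector field
of `v` at `g` to the image under `Φ` of the image of `v`. -/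
lemma modelDeriv_mulInvariantVectorField {f : S → M'} {Φ : M' → M'} {g : S}
    (hf : MDifferentiable 𝓘(ℝ, E) 𝓘(ℝ, E') f) (hΦ : MDifferentiable 𝓘(ℝ, E') 𝓘(ℝ, E') Φ)
    (h : ∀ x, f (g * x) = Φ (f x)) (v : GroupLieAlgebra 𝓘(ℝ, E) S) :
    modelDeriv (E := E) (E' := E') f g (mulInvariantVectorField v g) =
      modelDeriv (E := E') (E' := E') Φ (f 1) (modelDeriv (E := E) (E' := E') f 1 v) := by
  have h1 := modelDeriv_comp (E := E) (E' := E) (E'' := E') (f := fun x ↦ g * x) (g := f) (x := 1)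
    (hf _) (mdifferentiableAt_mul_left' g 1)
  have h2 := modelDeriv_comp (E := E) (E' := E') (E'' := E') (f := f) (g := Φ) (x := 1)
    (hΦ _) (hf _)
  simp only [h] at h1
  rw [h1, mul_one] at h2
  exact DFunLike.congr_fun h2 v

lemma modelDeriv_mul_left_surjective (g : S) :
    Function.Surjective (modelDeriv (E := E) (E' := E) (fun x ↦ g * x) (1 : S)) := by
  intro w
  have h := modelDeriv_comp (E := E) (E' := E) (E'' := E) (f := fun x ↦ g⁻¹ * x)
    (g := fun x ↦ g * x) (x := g) (mdifferentiableAt_mul_left' _ _) (mdifferentiableAt_mul_left' _ _)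
  simp only [mul_inv_cancel_left, modelDeriv_id, inv_mul_cancel] at h
  exact ⟨_, (DFunLike.congr_fun h w).symm⟩

end LeftInvariant

/-! ### The differential of a Lie group homomorphism. -/

section Homomorphism

open VectorField Filter Topology Set

variable {E : Type*} [NormedAddCommGroup E] [NormedSpace ℝ E]
  {S : Type*} [TopologicalSpace S] [ChartedSpace E S] [Group S]
  {E' : Type*} [NormedAddCommGroup E'] [NormedSpace ℝ E']
  {G : Type*} [TopologicalSpace G] [ChartedSpace E' G] [Group G]

lemma lieMap_eq_modelDeriv (ι : S →* G) (v : GroupLieAlgebra 𝓘(ℝ, E) S) :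
    lieMap (E := E) (E' := E') ι v = modelDeriv (E := E) (E' := E') ι 1 v := rfl

variable [LieGroup 𝓘(ℝ, E) ∞ S] [LieGroup 𝓘(ℝ, E') ∞ G]

lemma modelDeriv_monoidHom {ι : S →* G} (hι : ContMDiff 𝓘(ℝ, E) 𝓘(ℝ, E') ∞ ι) (s : S)
    (v : GroupLieAlgebra 𝓘(ℝ, E) S) :
    modelDeriv (E := E) (E' := E') ι s (mulInvariantVectorField v s) =
      mulInvariantVectorField (lieMap (E := E) (E' := E') ι v) (ι s) := by
  rw [modelDeriv_mulInvariantVectorField (Φ := fun x ↦ ι s * x) (hι.mdifferentiable (by simp))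
    (fun x ↦ mdifferentiableAt_mul_left' _ _) (fun x ↦ map_mul ι s x), map_one]
  rfl

/-- The differential of a homomorphism of Lie groups is a homomorphism of Lie algebras. -/
theorem lieMap_lie [FiniteDimensional ℝ E] [FiniteDimensional ℝ E']
    {ι : S →* G} (hι : ContMDiff 𝓘(ℝ, E) 𝓘(ℝ, E') ∞ ι)
    (v w : GroupLieAlgebra 𝓘(ℝ, E) S) :
    lieMap (E := E) (E' := E') ι ⁅v, w⁆ =
      ⁅lieMap (E := E) (E' := E') ι v, lieMap (E := E) (E' := E') ι w⁆ := by
  have : IsManifold 𝓘(ℝ, E) ∞ S := inferInstance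
  have hm : IsManifold 𝓘(ℝ, E') 1 G := IsManifold.of_le (n := ∞) (by simp)
  have hm2 : IsManifold 𝓘(ℝ, E') 2 G := IsManifold.of_le (n := ∞) ENat.LEInfty.out
  -- `ι` need not be a local diffeomorphism, so fields are not pulled back along it. Both brackets
  -- are tested on the chart `φ`, whose differential at `1` is injective.
  let φ : G → E' := fun x ↦ extChartAt 𝓘(ℝ, E') (1 : G) x
  have hφ2 : ContMDiffAt 𝓘(ℝ, E') 𝓘(ℝ, E') 2 φ 1 := contMDiffAt_extChartAt
  have hφι : ContMDiffAt 𝓘(ℝ, E) 𝓘(ℝ, E') 2 (fun s ↦ φ (ι s)) 1 := by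
    refine ContMDiffAt.comp (I' := 𝓘(ℝ, E')) (1 : S) (g := φ) ?_
      (hι.contMDiffAt.of_le ENat.LEInfty.out)
    rw [map_one]; exact hφ2
  have hιd : MDifferentiable 𝓘(ℝ, E) 𝓘(ℝ, E') ι := hι.mdifferentiable (by simp)
  have hS : ∀ v : GroupLieAlgebra 𝓘(ℝ, E) S, MDifferentiableAt 𝓘(ℝ, E) 𝓘(ℝ, E).tangent
      (fun g : S ↦ (mulInvariantVectorField v g : TangentBundle 𝓘(ℝ, E) S)) 1 := fun v ↦
    mdifferentiableAt_mulInvariantVectorField v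
  have hG : ∀ v : GroupLieAlgebra 𝓘(ℝ, E') G, MDifferentiableAt 𝓘(ℝ, E') 𝓘(ℝ, E').tangent
      (fun g : G ↦ (mulInvariantVectorField v g : TangentBundle 𝓘(ℝ, E') G)) 1 := fun v ↦
    mdifferentiableAt_mulInvariantVectorField v
  -- The left-invariant fields of `w` and of its image are `ι`-related.
  have key : ∀ w, fieldDeriv (fun s ↦ φ (ι s)) (mulInvariantVectorField w) =ᶠ[𝓝 (1 : S)]
      fun s ↦ fieldDeriv φ (mulInvariantVectorField (lieMap (E := E) (E' := E') ι w)) (ι s) := by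
    intro w
    have hs : ∀ᶠ s in 𝓝 (1 : S), ι s ∈ (chartAt E' (1 : G)).source := by
      apply hι.continuous.continuousAt
      rw [map_one]
      exact (chartAt E' (1 : G)).open_source.mem_nhds (mem_chart_source E' 1)
    filter_upwards [hs] with s hs
    rw [fieldDeriv_eq_modelDeriv, fieldDeriv_eq_modelDeriv, ← modelDeriv_monoidHom hι,
      modelDeriv_comp (mdifferentiableAt_extChartAt hs) (hιd s)]
    rfl
  have second : ∀ v w, fieldDeriv (fieldDeriv (fun s ↦ φ (ι s)) (mulInvariantVectorField w))
      (mulInvariantVectorField v) (1 : S) =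
      fieldDeriv (fieldDeriv φ (mulInvariantVectorField (lieMap (E := E) (E' := E') ι w)))
        (mulInvariantVectorField (lieMap (E := E) (E' := E') ι v)) (1 : G) := by
    intro v w
    have h1 : modelDeriv (E := E) (E' := E') (fieldDeriv (fun s ↦ φ (ι s))
        (mulInvariantVectorField w)) 1 = modelDeriv (E := E) (E' := E') (fun s ↦
        fieldDeriv φ (mulInvariantVectorField (lieMap (E := E) (E' := E') ι w)) (ι s)) 1 :=
      (key w).mfderiv_eq
    have hd := mdifferentiableAt_fieldDeriv hφ2 (hG (lieMap (E := E) (E' := E') ι w))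
    have hd' : MDifferentiableAt 𝓘(ℝ, E') 𝓘(ℝ, E') (fieldDeriv φ
        (mulInvariantVectorField (lieMap (E := E) (E' := E') ι w))) (ι 1) := by
      rw [map_one]
      exact hd
    rw [fieldDeriv_eq_modelDeriv, h1, modelDeriv_comp hd' (hιd 1)]
    refine (congrArg (modelDeriv _ _) (modelDeriv_monoidHom hι 1 v)).trans ?_
    rw [map_one]
    rfl
  have h := fieldDeriv_mlieBracket hφι (hS v) (hS w)
  have hφd : MDifferentiableAt 𝓘(ℝ, E') 𝓘(ℝ, E') φ (ι 1) := by
    rw [map_one]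
    exact mdifferentiableAt_extChartAt (mem_chart_source E' 1)
  rw [second, second, ← fieldDeriv_mlieBracket hφ2 (hG _) (hG _), fieldDeriv_eq_modelDeriv,
    fieldDeriv_eq_modelDeriv, modelDeriv_comp hφd (hιd 1), map_one] at h
  have hinv := isInvertible_mfderiv_extChartAt (mem_extChartAt_source (I := 𝓘(ℝ, E')) (1 : G))
  exact hinv.injective h

end Homomorphism

/-! ### Connection and curvature of a left-invariant metric. -/

section LeftInvariantMetric

open VectorField Filter Topology Set

variable {E : Type*} [NormedAddCommGroup E] [NormedSpace ℝ E]
  {S : Type*} [TopologicalSpace S] [ChartedSpace E S] [Group S]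

lemma mulInvariantVectorField_surjective [LieGroup 𝓘(ℝ, E) ∞ S] (g : S)
    (w : TangentSpace 𝓘(ℝ, E) g) :
    ∃ v : GroupLieAlgebra 𝓘(ℝ, E) S, mulInvariantVectorField v g = w :=
  modelDeriv_mul_left_surjective (E := E) g w

lemma mulInvariantVectorField_one' (v : GroupLieAlgebra 𝓘(ℝ, E) S) :
    mulInvariantVectorField v (1 : S) = v := mulInvariantVectorField_one v

variable [RiemannianBundle (fun x : S ↦ TangentSpace 𝓘(ℝ, E) x)]

variable (E S) in
/-- The inner product on the Lie algebra of a Lie group with a Riemannian metric. -/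
def lieMetric : LinearMap.BilinForm ℝ (GroupLieAlgebra 𝓘(ℝ, E) S) :=
  LinearMap.mk₂ ℝ (fun v w : TangentSpace 𝓘(ℝ, E) (1 : S) ↦ inner ℝ v w)
    (fun _ _ _ ↦ inner_add_left _ _ _) (fun _ _ _ ↦ real_inner_smul_left _ _ _)
    (fun _ _ _ ↦ inner_add_right _ _ _) (fun _ _ _ ↦ real_inner_smul_right _ _ _)

lemma lieMetric_comm (v w : GroupLieAlgebra 𝓘(ℝ, E) S) :
    lieMetric E S v w = lieMetric E S w v :=
  (real_inner_comm (F := TangentSpace 𝓘(ℝ, E) (1 : S)) v w).symm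

lemma lieMetric_pos (v : GroupLieAlgebra 𝓘(ℝ, E) S) (hv : v ≠ 0) : 0 < lieMetric E S v v :=
  metricAt_pos (E := E) (1 : S) v hv

variable (E S) in
/-- The Riemannian metric of the Lie group `S` is left-invariant. -/
def IsLeftInvariantMetric : Prop :=
  ∀ (g : S) (v w : GroupLieAlgebra 𝓘(ℝ, E) S),
    inner ℝ (mulInvariantVectorField v g) (mulInvariantVectorField w g) = lieMetric E S v w

lemma lieMetric_lieMap {E' : Type*} [NormedAddCommGroup E'] [NormedSpace ℝ E']
    {G : Type*} [TopologicalSpace G] [ChartedSpace E' G] [Group G]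
    [RiemannianBundle (fun x : G ↦ TangentSpace 𝓘(ℝ, E') x)] {ι : S →* G}
    (hι : IsIsometricImmersion (E := E) (E' := E') ι) (v w : GroupLieAlgebra 𝓘(ℝ, E) S) :
    lieMetric E' G (lieMap (E := E) (E' := E') ι v) (lieMap (E := E) (E' := E') ι w) =
      lieMetric E S v w := by
  refine Eq.trans ?_ (hι.metricAt_eq (1 : S) v w)
  rw [map_one]
  rfl

lemma IsLeftInvariantMetric.of_monoidHom [LieGroup 𝓘(ℝ, E) ∞ S]
    {E' : Type*} [NormedAddCommGroup E'] [NormedSpace ℝ E']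
    {G : Type*} [TopologicalSpace G] [ChartedSpace E' G] [Group G] [LieGroup 𝓘(ℝ, E') ∞ G]
    [RiemannianBundle (fun x : G ↦ TangentSpace 𝓘(ℝ, E') x)]
    (hG : IsLeftInvariantMetric E' G) {ι : S →* G}
    (hι : IsIsometricImmersion (E := E) (E' := E') ι) : IsLeftInvariantMetric E S := by
  intro g v w
  rw [← lieMetric_lieMap hι, ← hG (ι g)]
  refine (hι.metricAt_eq g (mulInvariantVectorField v g) (mulInvariantVectorField w g)).symm.trans
    (congrArg₂ (fun a b : E' ↦ metricAt (ι g) a b) (modelDeriv_monoidHom hι.1 g v)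
      (modelDeriv_monoidHom hι.1 g w))

/-- Through `f`, left translation by `g` becomes the isometry `Φ g`. -/
lemma IsLeftInvariantMetric.of_equivariant [LieGroup 𝓘(ℝ, E) ∞ S]
    {E' : Type*} [NormedAddCommGroup E'] [NormedSpace ℝ E']
    {M : Type*} [TopologicalSpace M] [ChartedSpace E' M]
    [RiemannianBundle (fun x : M ↦ TangentSpace 𝓘(ℝ, E') x)]
    {f : S → M} (hf : IsIsometricImmersion (E := E) (E' := E') f) {Φ : S → M → M}
    (hΦ : ∀ g, IsIsometricImmersion (E := E') (E' := E') (Φ g))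
    (h : ∀ g x, f (g * x) = Φ g (f x)) : IsLeftInvariantMetric E S := by
  intro g v w
  have hg : f g = Φ g (f 1) := by rw [← h, mul_one]
  have aux := modelDeriv_mulInvariantVectorField (hf.1.mdifferentiable (by simp))
      ((hΦ g).1.mdifferentiable (by simp)) (h g)
  refine (hf.metricAt_eq g (mulInvariantVectorField v g) (mulInvariantVectorField w g)).symm.trans
    ((congrArg₂ (fun a b : E' ↦ metricAt (f g) a b) (aux v) (aux w)).trans ?_)
  rw [hg]
  exact ((hΦ g).metricAt_eq _ _ _).trans (hf.metricAt_eq 1 v w)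

variable [FiniteDimensional ℝ E] [LieGroup 𝓘(ℝ, E) ∞ S]

/-- The value at the identity of the covariant derivative of left-invariant vector fields. -/
def leftCovariant (nabla : CovariantDerivative 𝓘(ℝ, E) E (TangentSpace 𝓘(ℝ, E) : S → Type _))
    (v w : GroupLieAlgebra 𝓘(ℝ, E) S) : GroupLieAlgebra 𝓘(ℝ, E) S :=
  nabla (mulInvariantVectorField w) 1 v

variable {nabla : CovariantDerivative 𝓘(ℝ, E) E (TangentSpace 𝓘(ℝ, E) : S → Type _)}

lemma IsLeviCivita.mulInvariantVectorField_sub (hn : IsLeviCivita nabla) (g : S)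
    (v w : GroupLieAlgebra 𝓘(ℝ, E) S) :
    nabla (mulInvariantVectorField w) g (mulInvariantVectorField v g) -
      nabla (mulInvariantVectorField v) g (mulInvariantVectorField w g) =
      mulInvariantVectorField ⁅v, w⁆ g := by
  have h := (CovariantDerivative.torsion_eq_zero_iff nabla).1 hn.torsion_eq_zero
    (mdifferentiableAt_mulInvariantVectorField (I := 𝓘(ℝ, E)) v (g := g))
    (mdifferentiableAt_mulInvariantVectorField w)
  rw [h, GroupLieAlgebra.bracket_def, mulInvariantVector_mlieBracket]

/-- The inner product of two left-invariant fields is constant, so its derivative drops out of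
metric compatibility. -/
lemma IsLeviCivita.inner_mulInvariantVectorField (hn : IsLeviCivita nabla)
    (hS : IsLeftInvariantMetric E S) (g : S) (u : TangentSpace 𝓘(ℝ, E) g)
    (v w : GroupLieAlgebra 𝓘(ℝ, E) S) :
    inner ℝ (nabla (mulInvariantVectorField v) g u) (mulInvariantVectorField w g) +
      inner ℝ (mulInvariantVectorField v g) (nabla (mulInvariantVectorField w) g u) = 0 := by
  have h := hn.metric (mulInvariantVectorField v) (mulInvariantVectorField w) g u
    (mdifferentiableAt_mulInvariantVectorField v) (mdifferentiableAt_mulInvariantVectorField w)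
  have hc : (fun y ↦ inner ℝ (mulInvariantVectorField (I := 𝓘(ℝ, E)) v y)
      (mulInvariantVectorField (I := 𝓘(ℝ, E)) w y)) =
      fun _ : S ↦ lieMetric E S v w := funext fun y ↦ hS y v w
  rw [hc, mfderiv_const] at h
  exact h.symm

/-- The Koszul formula for left-invariant vector fields. -/
lemma IsLeviCivita.koszul (hn : IsLeviCivita nabla)
    (hS : IsLeftInvariantMetric E S) (g : S) (u v w : GroupLieAlgebra 𝓘(ℝ, E) S) :
    2 * inner ℝ (nabla (mulInvariantVectorField v) g (mulInvariantVectorField u g))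
        (mulInvariantVectorField w g) =
      lieMetric E S ⁅u, v⁆ w - lieMetric E S ⁅v, w⁆ u + lieMetric E S ⁅w, u⁆ v := by
  have h1 := hn.inner_mulInvariantVectorField hS g (mulInvariantVectorField u g) v w
  have h2 := hn.inner_mulInvariantVectorField hS g (mulInvariantVectorField v g) w u
  have h3 := hn.inner_mulInvariantVectorField hS g (mulInvariantVectorField w g) u v
  have aux : ∀ a b c : GroupLieAlgebra 𝓘(ℝ, E) S, lieMetric E S ⁅a, b⁆ c =
      inner ℝ (nabla (mulInvariantVectorField b) g (mulInvariantVectorField a g))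
        (mulInvariantVectorField c g) -
      inner ℝ (nabla (mulInvariantVectorField a) g (mulInvariantVectorField b g))
        (mulInvariantVectorField c g) := by
    intro a b c
    rw [← hS g, ← hn.mulInvariantVectorField_sub, inner_sub_left]
  rw [aux, aux, aux]
  have h4 := real_inner_comm (nabla (mulInvariantVectorField w) g (mulInvariantVectorField u g))
    (mulInvariantVectorField v g)
  have h5 := real_inner_comm (nabla (mulInvariantVectorField u) g (mulInvariantVectorField v g))
    (mulInvariantVectorField w g)
  have h6 := real_inner_comm (nabla (mulInvariantVectorField v) g (mulInvariantVectorField w g))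
    (mulInvariantVectorField u g)
  linarith

/-- The covariant derivative of left-invariant vector fields is left-invariant. -/
lemma IsLeviCivita.nabla_mulInvariantVectorField (hn : IsLeviCivita nabla)
    (hS : IsLeftInvariantMetric E S) (g : S) (u v : GroupLieAlgebra 𝓘(ℝ, E) S) :
    nabla (mulInvariantVectorField v) g (mulInvariantVectorField u g) =
      mulInvariantVectorField (leftCovariant nabla u v) g := by
  -- The right-hand side of the Koszul formula does not depend on `g`.
  refine ext_inner_right ℝ fun w ↦ ?_
  obtain ⟨w, rfl⟩ := mulInvariantVectorField_surjective g w
  have h1 := hn.koszul hS g u v w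
  have h2 := hn.koszul hS 1 u v w
  rw [mulInvariantVectorField_one', mulInvariantVectorField_one'] at h2
  rw [hS g]
  exact mul_left_cancel₀ two_ne_zero (h1.trans h2.symm)

lemma IsLeviCivita.leftCovariant_sub (hn : IsLeviCivita nabla) (u v : GroupLieAlgebra 𝓘(ℝ, E) S) :
    leftCovariant nabla u v - leftCovariant nabla v u = ⁅u, v⁆ := by
  have h := hn.mulInvariantVectorField_sub 1 u v
  rwa [mulInvariantVectorField_one', mulInvariantVectorField_one',
    mulInvariantVectorField_one'] at h

lemma IsLeviCivita.lieMetric_leftCovariant (hn : IsLeviCivita nabla)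
    (hS : IsLeftInvariantMetric E S) (u v w : GroupLieAlgebra 𝓘(ℝ, E) S) :
    lieMetric E S (leftCovariant nabla u v) w + lieMetric E S v (leftCovariant nabla u w) = 0 := by
  have h := hn.inner_mulInvariantVectorField hS 1 u v w
  rw [mulInvariantVectorField_one', mulInvariantVectorField_one'] at h
  exact h

lemma IsLeviCivita.curvature_mulInvariantVectorField (hn : IsLeviCivita nabla)
    (hS : IsLeftInvariantMetric E S) (u v w : GroupLieAlgebra 𝓘(ℝ, E) S) :
    curvature nabla (mulInvariantVectorField u) (mulInvariantVectorField v)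
      (mulInvariantVectorField w) (1 : S) =
      leftCovariant nabla u (leftCovariant nabla v w) -
        leftCovariant nabla v (leftCovariant nabla u w) - leftCovariant nabla ⁅u, v⁆ w := by
  unfold curvature
  simp only [hn.nabla_mulInvariantVectorField hS, mulInvariantVectorField_one']
  rw [← GroupLieAlgebra.bracket_def]
  rfl

/-- The curvature operator of left-invariant vector fields, for an algebraic connection `U`. -/
def algebraicCurvature {L : Type*} [LieRing L] (U : L → L → L) (u v w : L) : L :=
  U u (U v w) - U v (U u w) - U ⁅u, v⁆ w

variable (E S) in
/-- The orthonormal basis of the Lie algebra used to compute the Ricci operator. -/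
def lieBasis (i : Fin (Module.finrank ℝ (TangentSpace 𝓘(ℝ, E) (1 : S)))) :
    GroupLieAlgebra 𝓘(ℝ, E) S :=
  stdOrthonormalBasis ℝ (TangentSpace 𝓘(ℝ, E) (1 : S)) i

omit [LieGroup 𝓘(ℝ, E) ∞ S] in
lemma sum_lieMetric_smul_lieBasis (v : GroupLieAlgebra 𝓘(ℝ, E) S) :
    ∑ i, lieMetric E S v (lieBasis E S i) • lieBasis E S i = v := by
  refine Eq.trans ?_ ((stdOrthonormalBasis ℝ (TangentSpace 𝓘(ℝ, E) (1 : S))).sum_repr' v)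
  refine Finset.sum_congr rfl fun i _ ↦ ?_
  rw [lieMetric_comm]
  rfl

lemma IsLeviCivita.ricciOperator_eq (hn : IsLeviCivita nabla)
    (hS : IsLeftInvariantMetric E S) (v : GroupLieAlgebra 𝓘(ℝ, E) S) :
    ricciOperator nabla v = ∑ i, algebraicCurvature (leftCovariant nabla) v (lieBasis E S i)
      (lieBasis E S i) :=
  Finset.sum_congr rfl fun _ _ ↦ hn.curvature_mulInvariantVectorField hS _ _ _

end LeftInvariantMetric

/-! ### Differentiation along curves. -/

section Curve

open VectorField Filter Topology Set

variable {E : Type*} [NormedAddCommGroup E] [NormedSpace ℝ E]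
  {M : Type*} [TopologicalSpace M] [ChartedSpace E M] [IsManifold 𝓘(ℝ, E) ∞ M]
  {F : Type*} [NormedAddCommGroup F] [NormedSpace ℝ F]

/-- The curve through `x` which is a straight line with direction `v` in the chart at `x`. -/
def chartCurve (x : M) (v : E) (t : ℝ) : M :=
  (extChartAt 𝓘(ℝ, E) x).symm (extChartAt 𝓘(ℝ, E) x x + t •
    modelDeriv (E := E) (E' := E) (extChartAt 𝓘(ℝ, E) x) x v)

omit [IsManifold 𝓘(ℝ, E) ∞ M] in
lemma chartCurve_zero (x : M) (v : E) : chartCurve x v 0 = x := by simp [chartCurve]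

omit [IsManifold 𝓘(ℝ, E) ∞ M] in
lemma tendsto_chartCurve (x : M) (v : E) : Tendsto (chartCurve x v) (𝓝 0) (𝓝 x) := by
  have h : ContinuousAt (chartCurve x v) 0 := by
    refine ContinuousAt.comp (g := (extChartAt 𝓘(ℝ, E) x).symm) ?_ (by fun_prop)
    simpa using continuousAt_extChartAt_symm (I := 𝓘(ℝ, E)) x
  simpa [ContinuousAt, chartCurve_zero] using h

lemma hasDerivAt_comp_chartCurve {f : M → F} {x : M}
    (hf : MDifferentiableAt 𝓘(ℝ, E) 𝓘(ℝ, F) f x) (v : E) :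
    HasDerivAt (fun t ↦ f (chartCurve x v t)) (modelDeriv (E := E) (E' := F) f x v) 0 := by
  have : IsManifold 𝓘(ℝ, E) 1 M := IsManifold.of_le (n := ∞) (by simp)
  have hd : DifferentiableAt ℝ (f ∘ (extChartAt 𝓘(ℝ, E) x).symm) (extChartAt 𝓘(ℝ, E) x x) := by
    have h := ((mdifferentiableAt_iff _ _).1 hf).2
    have hr : Set.range 𝓘(ℝ, E) = univ := by simp
    rw [writtenInExtChartAt, extChartAt_model_space_eq_id, hr] at h
    exact differentiableWithinAt_univ.1 h
  have h1 : f =ᶠ[𝓝 x] (f ∘ (extChartAt 𝓘(ℝ, E) x).symm) ∘ extChartAt 𝓘(ℝ, E) x := by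
    filter_upwards [extChartAt_source_mem_nhds (I := 𝓘(ℝ, E)) x] with y hy
    exact congrArg f ((extChartAt 𝓘(ℝ, E) x).left_inv hy).symm
  have h2 := mfderiv_comp x hd.mdifferentiableAt
    (mdifferentiableAt_extChartAt (I := 𝓘(ℝ, E)) (mem_chart_source E x))
  rw [mfderiv_eq_fderiv] at h2
  have h3 : modelDeriv (E := E) (E' := F) f x v =
      fderiv ℝ (f ∘ (extChartAt 𝓘(ℝ, E) x).symm) (extChartAt 𝓘(ℝ, E) x x)
        (modelDeriv (E := E) (E' := E) (extChartAt 𝓘(ℝ, E) x) x v) :=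
    (DFunLike.congr_fun (h1.mfderiv_eq (I := 𝓘(ℝ, E)) (I' := 𝓘(ℝ, F))) v).trans
      (DFunLike.congr_fun h2 v)
  rw [h3]
  exact hd.hasFDerivAt.hasLineDerivAt _

end Curve

/-! ### Frames with constant coordinates in a chart. -/

section ChartFrame

open VectorField Filter Topology Set

variable {E : Type*} [NormedAddCommGroup E] [NormedSpace ℝ E] [FiniteDimensional ℝ E]
  {M : Type*} [TopologicalSpace M] [ChartedSpace E M] [IsManifold 𝓘(ℝ, E) ∞ M]

/-- The vector field whose coordinates in the chart at `x` are constant, equal to `e`. -/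
def chartFrame (x : M) (e : E) : Π y : M, TangentSpace 𝓘(ℝ, E) y :=
  mpullback 𝓘(ℝ, E) 𝓘(ℝ, E) (extChartAt 𝓘(ℝ, E) x) (fun _ ↦ e)

lemma mdifferentiableAt_chartFrame (x : M) (e : E) :
    MDifferentiableAt 𝓘(ℝ, E) 𝓘(ℝ, E).tangent
      (fun y ↦ (chartFrame x e y : TangentBundle 𝓘(ℝ, E) M)) x := by
  have : IsManifold 𝓘(ℝ, E) 1 M := IsManifold.of_le (n := ∞) (by simp)
  have : IsManifold 𝓘(ℝ, E) 2 M := IsManifold.of_le (n := ∞) ENat.LEInfty.out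
  refine MDifferentiableAt.mpullback_vectorField (n := 2) ?_ contMDiffAt_extChartAt
    (isInvertible_mfderiv_extChartAt (mem_extChartAt_source x)) le_rfl
  exact (contMDiffAt_vectorSpace_iff_contDiffAt.2 (contDiffAt_const (c := e) (n := 1)
    (x := extChartAt 𝓘(ℝ, E) x x))).mdifferentiableAt (by simp)

omit [FiniteDimensional ℝ E] in
lemma chartFrame_modelDeriv {x y : M} (hy : y ∈ (chartAt E x).source) (v : E) :
    (chartFrame x (modelDeriv (E := E) (E' := E) (extChartAt 𝓘(ℝ, E) x) y v) y : E) = v := by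
  have : IsManifold 𝓘(ℝ, E) 1 M := IsManifold.of_le (n := ∞) (by simp)
  have hinv := isInvertible_mfderiv_extChartAt (I := 𝓘(ℝ, E)) (x := x) (y := y) (by simpa using hy)
  exact hinv.inverse_apply_self v

omit [FiniteDimensional ℝ E] [IsManifold 𝓘(ℝ, E) ∞ M] in
-- Bilinear expansion. It isolates the coefficients of the metric, which are functions of the point
-- `y` alone, from the coordinates `u`, `v`.
lemma metricAt_chartFrame [RiemannianBundle (fun x : M ↦ TangentSpace 𝓘(ℝ, E) x)]
    {ι : Type*} [Fintype ι] (b : Module.Basis ι ℝ E) (x y : M) (u v : E) :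
    metricAt (E := E) y (chartFrame x u y) (chartFrame x v y) =
      ∑ i, ∑ j, b.repr u i * b.repr v j *
        metricAt (E := E) y (chartFrame x (b i) y) (chartFrame x (b j) y) := by
  let A : E →L[ℝ] E := (modelDeriv (E := E) (E' := E) (extChartAt 𝓘(ℝ, E) x) y).inverse
  have hA : ∀ e, (chartFrame x e y : E) = A e := fun _ ↦ rfl
  simp only [hA]
  conv_lhs => rw [← b.sum_repr u, ← b.sum_repr v]
  simp only [map_sum, map_smul, sum_apply, smul_apply,
    smul_eq_mul, Finset.mul_sum]
  rw [Finset.sum_comm]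
  exact Finset.sum_congr rfl fun i _ ↦ Finset.sum_congr rfl fun j _ ↦ by ring

end ChartFrame

/-! ### Invariance of the pulled-back metric under vertical fields. -/

section VerticalInvariance

open VectorField Filter Topology Set

variable {E : Type*} [NormedAddCommGroup E] [NormedSpace ℝ E] [FiniteDimensional ℝ E]
  {G : Type*} [TopologicalSpace G] [ChartedSpace E G] [Group G] [LieGroup 𝓘(ℝ, E) ∞ G]
  {F : Type*} [NormedAddCommGroup F] [NormedSpace ℝ F] [FiniteDimensional ℝ F]
  {M : Type*} [TopologicalSpace M] [ChartedSpace F M] [IsManifold 𝓘(ℝ, F) ∞ M]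

/-- The image of a left-invariant vector field, read in a chart of the target. -/
def chartImage (p : G → M) (v : GroupLieAlgebra 𝓘(ℝ, E) G) : G → F :=
  fieldDeriv (fun g ↦ extChartAt 𝓘(ℝ, F) (p 1) (p g)) (mulInvariantVectorField v)

omit [FiniteDimensional ℝ E] [LieGroup 𝓘(ℝ, E) ∞ G] [FiniteDimensional ℝ F] in
lemma chartImage_eq {p : G → M} (hp : ContMDiff 𝓘(ℝ, E) 𝓘(ℝ, F) ∞ p)
    (v : GroupLieAlgebra 𝓘(ℝ, E) G) {g : G} (hg : p g ∈ (chartAt F (p 1)).source) :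
    chartImage (F := F) p v g = modelDeriv (E := F) (E' := F) (extChartAt 𝓘(ℝ, F) (p 1)) (p g)
      (modelDeriv (E := E) (E' := F) p g (mulInvariantVectorField v g)) := by
  have : IsManifold 𝓘(ℝ, F) 1 M := IsManifold.of_le (n := ∞) (by simp)
  have h := modelDeriv_comp (E := E) (E' := F) (E'' := F)
    (g := fun x ↦ extChartAt 𝓘(ℝ, F) (p 1) x) (mdifferentiableAt_extChartAt hg)
    (hp.mdifferentiable (by simp) g)
  exact DFunLike.congr_fun h (mulInvariantVectorField v g)

omit [FiniteDimensional ℝ E] [LieGroup 𝓘(ℝ, E) ∞ G] [FiniteDimensional ℝ F] in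
lemma contMDiffAt_chart_comp {p : G → M} (hp : ContMDiff 𝓘(ℝ, E) 𝓘(ℝ, F) ∞ p) :
    ContMDiffAt 𝓘(ℝ, E) 𝓘(ℝ, F) 2 (fun g ↦ extChartAt 𝓘(ℝ, F) (p 1) (p g)) 1 := by
  have : IsManifold 𝓘(ℝ, F) 2 M := IsManifold.of_le (n := ∞) ENat.LEInfty.out
  exact ContMDiffAt.comp (I' := 𝓘(ℝ, F)) (1 : G) (g := fun x ↦ extChartAt 𝓘(ℝ, F) (p 1) x)
    contMDiffAt_extChartAt (hp.contMDiffAt.of_le ENat.LEInfty.out)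

omit [FiniteDimensional ℝ E] [LieGroup 𝓘(ℝ, E) ∞ G] [FiniteDimensional ℝ F]
  [IsManifold 𝓘(ℝ, F) ∞ M] in
lemma eventually_mem_chart_source {p : G → M} (hp : ContMDiff 𝓘(ℝ, E) 𝓘(ℝ, F) ∞ p) :
    ∀ᶠ g in 𝓝 (1 : G), p g ∈ (chartAt F (p 1)).source :=
  hp.continuous.continuousAt ((chartAt F (p 1)).open_source.mem_nhds (mem_chart_source F _))

omit [FiniteDimensional ℝ F] in
-- With `f` the map `p` read in the chart, `z(v f) = [z, v] f + v(z f)`, and `z f` vanishes near `1`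
-- because `z` is vertical.
lemma hasDerivAt_chartImage {p : G → M} (hp : ContMDiff 𝓘(ℝ, E) 𝓘(ℝ, F) ∞ p)
    {z : GroupLieAlgebra 𝓘(ℝ, E) G}
    (hz : ∀ g, modelDeriv (E := E) (E' := F) p g (mulInvariantVectorField z g) = 0)
    (v : GroupLieAlgebra 𝓘(ℝ, E) G) :
    HasDerivAt (fun t ↦ chartImage (F := F) p v (chartCurve (E := E) (1 : G) z t))
      (chartImage (F := F) p ⁅z, v⁆ 1) 0 := by
  have hf := contMDiffAt_chart_comp hp
  have hX : ∀ v : GroupLieAlgebra 𝓘(ℝ, E) G, MDifferentiableAt 𝓘(ℝ, E) 𝓘(ℝ, E).tangent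
      (fun g : G ↦ (mulInvariantVectorField v g : TangentBundle 𝓘(ℝ, E) G)) 1 := fun v ↦
    mdifferentiableAt_mulInvariantVectorField v
  have h := hasDerivAt_comp_chartCurve (mdifferentiableAt_fieldDeriv hf (hX v)) z
  refine h.congr_deriv ?_
  have hb := fieldDeriv_mlieBracket hf (hX z) (hX v)
  have h0 : fieldDeriv (fun g ↦ extChartAt 𝓘(ℝ, F) (p 1) (p g)) (mulInvariantVectorField z)
      =ᶠ[𝓝 (1 : G)] fun _ ↦ (0 : F) := by
    filter_upwards [eventually_mem_chart_source hp] with g hg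
    have := chartImage_eq hp z hg
    rw [hz, map_zero] at this
    exact this
  have h1 : fieldDeriv (fieldDeriv (fun g ↦ extChartAt 𝓘(ℝ, F) (p 1) (p g))
      (mulInvariantVectorField z)) (mulInvariantVectorField v) (1 : G) = 0 := by
    have h2 : modelDeriv (E := E) (E' := F) (fieldDeriv (fun g ↦ extChartAt 𝓘(ℝ, F) (p 1) (p g))
      (mulInvariantVectorField z)) (1 : G) = 0 := h0.mfderiv_eq.trans mfderiv_const
    rw [fieldDeriv_eq_modelDeriv, h2]
    rfl
  rw [h1, sub_zero, ← mulInvariantVector_mlieBracket, ← GroupLieAlgebra.bracket_def] at hb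
  refine Eq.trans ?_ hb.symm
  rw [fieldDeriv_eq_modelDeriv]
  exact congrArg (modelDeriv (E := E) (E' := F) _ _) (mulInvariantVectorField_one z).symm

/-- If the pullback of a Riemannian metric to a Lie group is left-invariant, then it is also
invariant under the left-invariant vector fields which are vertical. -/
theorem metricAt_lie_add_metricAt_lie [RiemannianBundle (fun x : M ↦ TangentSpace 𝓘(ℝ, F) x)]
    [IsContMDiffRiemannianBundle 𝓘(ℝ, F) ∞ F (fun x : M ↦ TangentSpace 𝓘(ℝ, F) x)]
    {p : G → M} (hp : ContMDiff 𝓘(ℝ, E) 𝓘(ℝ, F) ∞ p)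
    (hinv : ∀ (g : G) (v w : GroupLieAlgebra 𝓘(ℝ, E) G),
      metricAt (E := F) (p g) (modelDeriv (E := E) (E' := F) p g (mulInvariantVectorField v g))
        (modelDeriv (E := E) (E' := F) p g (mulInvariantVectorField w g)) =
      metricAt (E := F) (p 1) (modelDeriv (E := E) (E' := F) p 1 v)
        (modelDeriv (E := E) (E' := F) p 1 w))
    {z : GroupLieAlgebra 𝓘(ℝ, E) G}
    (hz : ∀ g, modelDeriv (E := E) (E' := F) p g (mulInvariantVectorField z g) = 0)
    (v w : GroupLieAlgebra 𝓘(ℝ, E) G) :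
    metricAt (E := F) (p 1) (modelDeriv (E := E) (E' := F) p 1
        (⁅z, v⁆ : GroupLieAlgebra 𝓘(ℝ, E) G)) (modelDeriv (E := E) (E' := F) p 1 w) +
      metricAt (E := F) (p 1) (modelDeriv (E := E) (E' := F) p 1 v)
        (modelDeriv (E := E) (E' := F) p 1 (⁅z, w⁆ : GroupLieAlgebra 𝓘(ℝ, E) G)) = 0 := by
  set b := Module.finBasis ℝ F
  set c := chartCurve (E := E) (1 : G) z
  let h : Fin (Module.finrank ℝ F) → Fin (Module.finrank ℝ F) → M → ℝ := fun i j x ↦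
    metricAt (E := F) x (chartFrame (p 1) (b i) x) (chartFrame (p 1) (b j) x)
  have frame : ∀ (v : GroupLieAlgebra 𝓘(ℝ, E) G) {g : G}, p g ∈ (chartAt F (p 1)).source →
      modelDeriv (E := E) (E' := F) p g (mulInvariantVectorField v g) =
        chartFrame (p 1) (chartImage (F := F) p v g) (p g) := by
    intro v g hg
    rw [chartImage_eq hp v hg]
    exact (chartFrame_modelDeriv hg _).symm
  have expand : ∀ (v w : GroupLieAlgebra 𝓘(ℝ, E) G) {g : G}, p g ∈ (chartAt F (p 1)).source →
      metricAt (E := F) (p g) (modelDeriv (E := E) (E' := F) p g (mulInvariantVectorField v g))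
        (modelDeriv (E := E) (E' := F) p g (mulInvariantVectorField w g)) =
      ∑ i, ∑ j, b.repr (chartImage (F := F) p v g) i * b.repr (chartImage (F := F) p w g) j *
        h i j (p g) := by
    intro v w g hg
    rw [frame v hg, frame w hg]
    exact metricAt_chartFrame b (p 1) (p g) _ _
  have expand_one : ∀ v w : GroupLieAlgebra 𝓘(ℝ, E) G,
      metricAt (E := F) (p 1) (modelDeriv (E := E) (E' := F) p 1 v)
        (modelDeriv (E := E) (E' := F) p 1 w) =
      ∑ i, ∑ j, b.repr (chartImage (F := F) p v 1) i * b.repr (chartImage (F := F) p w 1) j *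
        h i j (p 1) := by
    intro v w
    exact (hinv 1 v w).symm.trans (expand v w (mem_chart_source F _))
  -- Left-invariance makes the metric of the two images constant along `c`; the theorem is the
  -- derivative of this identity at `0`.
  have hconst : (fun t ↦ ∑ i, ∑ j, b.repr (chartImage (F := F) p v (c t)) i *
      b.repr (chartImage (F := F) p w (c t)) j * h i j (p (c t))) =ᶠ[𝓝 0] fun _ ↦
      metricAt (E := F) (p 1) (modelDeriv (E := E) (E' := F) p 1 v)
        (modelDeriv (E := E) (E' := F) p 1 w) := by
    filter_upwards [tendsto_chartCurve (E := E) (1 : G) z (eventually_mem_chart_source hp)]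
      with t ht
    exact (expand v w ht).symm.trans (hinv _ v w)
  have hcoord : ∀ (v : GroupLieAlgebra 𝓘(ℝ, E) G) i,
      HasDerivAt (fun t ↦ b.repr (chartImage (F := F) p v (c t)) i)
        (b.repr (chartImage (F := F) p ⁅z, v⁆ 1) i) 0 := by
    intro v i
    exact (b.coord i).toContinuousLinearMap.hasFDerivAt.comp_hasDerivAt (0 : ℝ)
      (hasDerivAt_chartImage hp hz v)
  -- The metric coefficients depend only on `p (c t)`, whose velocity at `0` is the image of `z`,
  -- that is zero.
  have hh : ∀ i j, HasDerivAt (fun t ↦ h i j (p (c t))) 0 0 := by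
    intro i j
    have hd : MDifferentiableAt 𝓘(ℝ, F) 𝓘(ℝ, ℝ) (h i j) (p 1) :=
      MDifferentiableAt.inner_bundle (E := fun x : M ↦ TangentSpace 𝓘(ℝ, F) x) (b := fun x ↦ x)
        (v := chartFrame (p 1) (b i)) (w := chartFrame (p 1) (b j)) (mdifferentiableAt_chartFrame (p 1) (b i))
        (mdifferentiableAt_chartFrame (p 1) (b j))
    have hpd : MDifferentiableAt 𝓘(ℝ, E) 𝓘(ℝ, F) p 1 := hp.mdifferentiable (by simp) 1
    have h1 := hasDerivAt_comp_chartCurve (hd.comp (1 : G) hpd) z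
    have h2 := DFunLike.congr_fun (modelDeriv_comp (E := E) hd hpd) z
    have h3 : modelDeriv (E := E) (E' := F) p 1 z = 0 := by
      rw [← hz 1]
      exact congrArg _ (mulInvariantVectorField_one z).symm
    have h4 : modelDeriv (E := E) (E' := ℝ) (h i j ∘ p) 1 z = 0 :=
      h2.trans ((congrArg (modelDeriv (E := F) (E' := ℝ) (h i j) (p 1)) h3).trans (map_zero _))
    rw [h4] at h1
    exact h1
  have hderiv := HasDerivAt.fun_sum (u := Finset.univ) fun i _ ↦ HasDerivAt.fun_sum
    (u := Finset.univ) fun j _ ↦ (((hcoord v i).mul (hcoord w j)).mul (hh i j))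
  have huniq := hderiv.unique ((hasDerivAt_const (0 : ℝ) _).congr_of_eventuallyEq hconst)
  rw [expand_one, expand_one, ← Finset.sum_add_distrib]
  rw [← huniq]
  refine Finset.sum_congr rfl fun i _ ↦ ?_
  rw [← Finset.sum_add_distrib]
  refine Finset.sum_congr rfl fun j _ ↦ ?_
  have hc : c 0 = 1 := chartCurve_zero _ _
  simp only [hc, mul_zero, add_zero]
  ring

end VerticalInvariance

/-! ### The form on the Lie algebra of `G` induced by an orbit. -/

section OrbitForm

variable {E : Type*} [NormedAddCommGroup E] [NormedSpace ℝ E]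
  {G : Type*} [TopologicalSpace G] [ChartedSpace E G] [Group G]
  {F : Type*} [NormedAddCommGroup F] [NormedSpace ℝ F]
  {M : Type*} [TopologicalSpace M] [ChartedSpace F M] [MulAction G M]
  [RiemannianBundle (fun x : M ↦ TangentSpace 𝓘(ℝ, F) x)]

variable (E G F) in
/-- The symmetric bilinear form on the Lie algebra of `G` obtained by pulling back the metric along
the orbit map. -/
def orbitForm (o : M) : LinearMap.BilinForm ℝ (GroupLieAlgebra 𝓘(ℝ, E) G) :=
  LinearMap.mk₂ ℝ (fun v w : TangentSpace 𝓘(ℝ, E) (1 : G) ↦ orbitInner (F := F) o v w)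
    (fun _ _ _ ↦ by simp only [orbitInner, map_add, inner_add_left])
    (fun _ _ _ ↦ by simp only [orbitInner, map_smul, real_inner_smul_left, smul_eq_mul])
    (fun _ _ _ ↦ by simp only [orbitInner, map_add, inner_add_right])
    (fun _ _ _ ↦ by simp only [orbitInner, map_smul, real_inner_smul_right, smul_eq_mul])

lemma orbitForm_eq_metricAt (o : M) (v w : GroupLieAlgebra 𝓘(ℝ, E) G) :
    orbitForm E G F o v w = metricAt (E := F) ((1 : G) • o)
      (modelDeriv (E := E) (E' := F) (fun g : G ↦ g • o) 1 v)
      (modelDeriv (E := E) (E' := F) (fun g : G ↦ g • o) 1 w) := rfl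

lemma orbitForm_comm (o : M) (v w : GroupLieAlgebra 𝓘(ℝ, E) G) :
    orbitForm E G F o v w = orbitForm E G F o w v := metricAt_comm (E := F) _ _ _

lemma orbitForm_pos (o : M) (v : GroupLieAlgebra 𝓘(ℝ, E) G)
    (hv : orbitMapDeriv (F := F) o v ≠ 0) : 0 < orbitForm E G F o v v := metricAt_pos (E := F) _ _ hv

lemma orbitForm_eq_zero (o : M) (v w : GroupLieAlgebra 𝓘(ℝ, E) G)
    (hv : orbitMapDeriv (F := F) o v = 0) : orbitForm E G F o v w = 0 := by
  have h : modelDeriv (E := E) (E' := F) (fun g : G ↦ g • o) 1 v = 0 := hv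
  rw [orbitForm_eq_metricAt, h, map_zero]
  rfl

/-- The orbit map is equivariant, so the image of a left-invariant field at `g` is the isometry `g`
applied to its image at `1`. Hence inner products of images are constant, and a field vertical at
`1` is vertical everywhere. -/
theorem orbitForm_lie_add_orbitForm_lie [FiniteDimensional ℝ E] [LieGroup 𝓘(ℝ, E) ∞ G]
    [FiniteDimensional ℝ F] [IsManifold 𝓘(ℝ, F) ∞ M]
    [IsContMDiffRiemannianBundle 𝓘(ℝ, F) ∞ F (fun x : M ↦ TangentSpace 𝓘(ℝ, F) x)]
    (o : M) (smooth : ContMDiffSMul 𝓘(ℝ, E) 𝓘(ℝ, F) ∞ G M)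
    (isometric : ∀ g : G, IsIsometricImmersion (E := F) (E' := F) (fun x : M ↦ g • x))
    {z : GroupLieAlgebra 𝓘(ℝ, E) G} (hz : orbitMapDeriv (F := F) o z = 0)
    (v w : GroupLieAlgebra 𝓘(ℝ, E) G) :
    orbitForm E G F o ⁅z, v⁆ w + orbitForm E G F o v ⁅z, w⁆ = 0 := by
  have hp : ContMDiff 𝓘(ℝ, E) 𝓘(ℝ, F) ∞ (fun g : G ↦ g • o) :=
    (contMDiff_id (I := 𝓘(ℝ, E)) (M := G)).smul contMDiff_const
  have key : ∀ (g : G) (v : GroupLieAlgebra 𝓘(ℝ, E) G),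
      modelDeriv (E := E) (E' := F) (fun g : G ↦ g • o) g (mulInvariantVectorField v g) =
      modelDeriv (E := F) (E' := F) (fun x : M ↦ g • x) ((1 : G) • o)
        (modelDeriv (E := E) (E' := F) (fun g : G ↦ g • o) 1 v) := fun g v ↦
    modelDeriv_mulInvariantVectorField (Φ := fun x : M ↦ g • x) (hp.mdifferentiable (by simp))
      ((isometric g).1.mdifferentiable (by simp)) (fun x ↦ mul_smul g x o) v
  refine metricAt_lie_add_metricAt_lie hp (fun g v w ↦ ?_) (fun g ↦ ?_) v w
  · have hg : g • o = g • ((1 : G) • o) := by rw [one_smul]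
    rw [key g v, key g w, hg]
    exact (isometric g).metricAt_eq _ _ _
  · rw [key g z]
    exact (congrArg _ (show modelDeriv (E := E) (E' := F) (fun g : G ↦ g • o) 1 z = 0 from
      hz)).trans (map_zero _)

end OrbitForm

/-! ### Spectral theory relative to a positive definite form. -/

section SymmetricForms

variable {V : Type*} [AddCommGroup V] [Module ℝ V]

/-- The inner product given by a positive definite symmetric bilinear form. -/
abbrev innerCoreOfPosDef {B : LinearMap.BilinForm ℝ V}
    (hBs : ∀ x y, B x y = B y x) (hBp : ∀ x, x ≠ 0 → 0 < B x x) : InnerProductSpace.Core ℝ V where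
  inner x y := B x y
  conj_inner_symm x y := hBs y x
  re_inner_nonneg x := by
    rcases eq_or_ne x 0 with rfl | h
    · simp
    · exact (hBp x h).le
  add_left x y z := by simp
  smul_left x y r := by simp
  definite x h := by
    by_contra hx
    exact (hBp x hx).ne' h

variable [FiniteDimensional ℝ V]

/-- A symmetric bilinear form has an eigenvector with respect to a positive definite one. -/
lemma exists_relative_eigenvector [Nontrivial V] {B Q : LinearMap.BilinForm ℝ V}
    (hBs : ∀ x y, B x y = B y x) (hBp : ∀ x, x ≠ 0 → 0 < B x x) (hQ : ∀ x y, Q x y = Q y x) :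
    ∃ (c : ℝ) (v : V), v ≠ 0 ∧ ∀ w, Q v w = c * B v w := by
  let core := innerCoreOfPosDef hBs hBp
  let _ : NormedAddCommGroup V := core.toNormedAddCommGroup
  let _ : InnerProductSpace ℝ V := .ofCore core.toCore
  have hnd : B.Nondegenerate := by
    rw [LinearMap.BilinForm.nondegenerate_iff_ker_eq_bot, LinearMap.ker_eq_bot']
    intro x hx
    by_contra h
    have := hBp x h
    rw [hx] at this
    simp at this
  -- The operator representing `Q` through `B`; it is `B`-self-adjoint because `Q` is symmetric.
  let T : V →ₗ[ℝ] V := (B.toDual hnd).symm.toLinearMap ∘ₗ Q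
  have hT : ∀ x y, B (T x) y = Q x y := fun x y ↦ by
    rw [← LinearMap.BilinForm.toDual_def hnd]
    simp [T]
  have hTs : T.IsSymmetric := fun x y ↦ by
    change B (T x) y = B x (T y)
    rw [hT, hBs x, hT, hQ]
  obtain ⟨c, hc⟩ : ∃ c : ℝ, Module.End.HasEigenvalue T c :=
    ⟨_, hTs.hasEigenvalue_iSup_of_finiteDimensional⟩
  obtain ⟨v, hv⟩ := hc.exists_hasEigenvector
  refine ⟨c, v, hv.2, fun w ↦ ?_⟩
  rw [← hT, hv.apply_eq_smul, map_smul]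
  rfl

/-- Commuting operators which are symmetric for a positive definite form are simultaneously
diagonalizable. -/
lemma iSup_iInf_eigenspace_eq_top {B : LinearMap.BilinForm ℝ V}
    (hBs : ∀ x y, B x y = B y x) (hBp : ∀ x, x ≠ 0 → 0 < B x x) {ι : Type*} {T : ι → Module.End ℝ V}
    (hT : ∀ i x y, B (T i x) y = B x (T i y)) (hc : ∀ i j, Commute (T i) (T j)) :
    ⨆ χ : ι → ℝ, ⨅ i, Module.End.eigenspace (T i) (χ i) = ⊤ := by
  let core := innerCoreOfPosDef hBs hBp
  let _ : NormedAddCommGroup V := core.toNormedAddCommGroup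
  let _ : InnerProductSpace ℝ V := .ofCore core.toCore
  exact LinearMap.IsSymmetric.iSup_iInf_eq_top_of_commute (fun i x y ↦ hT i x y)
    (fun i j _ ↦ hc i j)

end SymmetricForms

/-! ### Cartan involutions and Schur's lemma. -/

section Cartan

variable {L : Type*} [LieRing L] [LieAlgebra ℝ L]

/-- `Q` is the pullback to the Lie algebra of a `K`-invariant metric on `𝔭`, where `θ` is a Cartan
involution whose isotropy representation on `𝔭` is irreducible. -/
structure IsCartanForm (θ : L →ₗ⁅ℝ⁆ L) (Q : LinearMap.BilinForm ℝ L) : Prop where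
  involutive (X : L) : θ (θ X) = X
  cartan (X : L) : X ≠ 0 → 0 < -killingForm ℝ L (θ X) X
  symm (X Y : L) : Q X Y = Q Y X
  pos (X : L) : θ X ≠ X → 0 < Q X X
  vertical (X Y : L) : θ X = X → Q X Y = 0
  invariant (Z X Y : L) : θ Z = Z → Q ⁅Z, X⁆ Y + Q X ⁅Z, Y⁆ = 0
  nontrivial : ∃ X : L, X ≠ 0 ∧ θ X = -X
  irreducible (W : Submodule ℝ L) : (∀ X ∈ W, θ X = -X) →
    (∀ X Y : L, θ X = X → Y ∈ W → ⁅X, Y⁆ ∈ W) → W = ⊥ ∨ ∀ X, θ X = -X → X ∈ W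

/-- The component in `𝔨`. -/
def kPart (θ : L →ₗ⁅ℝ⁆ L) : L →ₗ[ℝ] L := (2⁻¹ : ℝ) • (LinearMap.id + θ.toLinearMap)

/-- The component in `𝔭`. -/
def pPart (θ : L →ₗ⁅ℝ⁆ L) : L →ₗ[ℝ] L := (2⁻¹ : ℝ) • (LinearMap.id - θ.toLinearMap)

lemma kPart_apply (θ : L →ₗ⁅ℝ⁆ L) (X : L) : kPart θ X = (2⁻¹ : ℝ) • (X + θ X) := rfl

lemma pPart_apply (θ : L →ₗ⁅ℝ⁆ L) (X : L) : pPart θ X = (2⁻¹ : ℝ) • (X - θ X) := rfl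

lemma kPart_add_pPart (θ : L →ₗ⁅ℝ⁆ L) (X : L) : kPart θ X + pPart θ X = X := by
  rw [kPart_apply, pPart_apply]
  module

lemma pPart_eq_self {θ : L →ₗ⁅ℝ⁆ L} {X : L} (h : θ X = -X) : pPart θ X = X := by
  rw [pPart_apply, h]
  module

lemma kPart_eq_zero {θ : L →ₗ⁅ℝ⁆ L} {X : L} (h : θ X = -X) : kPart θ X = 0 := by
  rw [kPart_apply, h]
  module

lemma killingForm_lie (X Y Z : L) : killingForm ℝ L ⁅X, Y⁆ Z = -killingForm ℝ L Y ⁅X, Z⁆ :=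
  LieModule.traceForm_apply_lie_apply' ℝ L L X Y Z

lemma killingForm_comm (X Y : L) : killingForm ℝ L X Y = killingForm ℝ L Y X :=
  LieModule.traceForm_comm ℝ L L X Y

namespace IsCartanForm

variable {θ : L →ₗ⁅ℝ⁆ L} {Q : LinearMap.BilinForm ℝ L}

lemma map_kPart (h : IsCartanForm θ Q) (X : L) : θ (kPart θ X) = kPart θ X := by
  rw [kPart_apply, map_smul, map_add, h.involutive, add_comm]

lemma map_pPart (h : IsCartanForm θ Q) (X : L) : θ (pPart θ X) = -pPart θ X := by
  rw [pPart_apply, map_smul, map_sub, h.involutive, ← smul_neg, neg_sub]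

lemma killingForm_map (h : IsCartanForm θ Q) (X Y : L) :
    killingForm ℝ L (θ X) (θ Y) = killingForm ℝ L X Y := by
  let e : L ≃ₗ⁅ℝ⁆ L := { θ with
    invFun := θ
    left_inv := h.involutive
    right_inv := h.involutive }
  exact LieAlgebra.killingForm_of_equiv_apply e X Y

lemma killingForm_map_left (h : IsCartanForm θ Q) (X Y : L) :
    killingForm ℝ L (θ X) Y = killingForm ℝ L X (θ Y) := by
  rw [← h.killingForm_map, h.involutive]

lemma killingForm_pos (h : IsCartanForm θ Q) {X : L} (hX : θ X = -X) (h0 : X ≠ 0) :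
    0 < killingForm ℝ L X X := by
  have := h.cartan X h0
  rwa [hX, map_neg, LinearMap.neg_apply, neg_neg] at this

lemma apply_pPart (h : IsCartanForm θ Q) (X Y : L) : Q (pPart θ X) Y = Q X Y := by
  conv_rhs => rw [← kPart_add_pPart θ X, map_add, LinearMap.add_apply,
    h.vertical _ _ (h.map_kPart X), zero_add]

lemma apply_pPart_right (h : IsCartanForm θ Q) (X Y : L) : Q X (pPart θ Y) = Q X Y := by
  rw [h.symm, h.apply_pPart, h.symm]

/-- Schur's lemma: an invariant metric on `𝔭` is a multiple of the Killing form. -/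
theorem exists_eq_killingForm [FiniteDimensional ℝ L] (h : IsCartanForm θ Q) :
    ∃ c : ℝ, 0 < c ∧ ∀ X Y : L, θ X = -X → θ Y = -Y → Q X Y = c * killingForm ℝ L X Y := by
  let p : Submodule ℝ L := LinearMap.range (pPart θ)
  have hp : ∀ {X}, X ∈ p ↔ θ X = -X := by
    intro X
    constructor
    · rintro ⟨Y, rfl⟩
      exact h.map_pPart Y
    · exact fun hX ↦ ⟨X, pPart_eq_self hX⟩
  obtain ⟨X₀, hX₀, hX₀'⟩ := h.nontrivial
  have : Nontrivial p := ⟨⟨X₀, hp.2 hX₀'⟩, 0, fun he ↦ hX₀ (congrArg Subtype.val he)⟩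
  obtain ⟨c, v, hv, hc⟩ := exists_relative_eigenvector
    (B := (killingForm ℝ L).restrict p) (Q := Q.restrict p)
    (fun x y ↦ killingForm_comm _ _)
    (fun x hx ↦ h.killingForm_pos (hp.1 x.2) (fun h0 ↦ hx (Subtype.ext h0)))
    (fun x y ↦ h.symm _ _)
  -- The eigenspace for `c` of `Q` relative to the Killing form. It is stable under `𝔨` since both
  -- forms are invariant, and it contains `v ≠ 0`, so irreducibility makes it all of `𝔭`.
  let W : Submodule ℝ L :=
    { carrier := {X | θ X = -X ∧ ∀ Y, θ Y = -Y → Q X Y = c * killingForm ℝ L X Y}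
      add_mem' := by
        rintro X X' ⟨h1, h2⟩ ⟨h3, h4⟩
        refine ⟨by rw [map_add, h1, h3, neg_add], fun Y hY ↦ ?_⟩
        rw [map_add, map_add, LinearMap.add_apply, LinearMap.add_apply, h2 Y hY, h4 Y hY, mul_add]
      zero_mem' := ⟨by simp, fun Y _ ↦ by simp⟩
      smul_mem' := by
        rintro r X ⟨h1, h2⟩
        refine ⟨by rw [map_smul, h1, smul_neg], fun Y hY ↦ ?_⟩
        rw [map_smul, map_smul, LinearMap.smul_apply, LinearMap.smul_apply, h2 Y hY, smul_eq_mul,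
          smul_eq_mul]
        ring }
  have hvW : (v : L) ∈ W := ⟨hp.1 v.2, fun Y hY ↦ hc ⟨Y, hp.2 hY⟩⟩
  have hW := h.irreducible W (fun X hX ↦ hX.1) (fun Z X hZ hX ↦
    ⟨by rw [LieHom.map_lie, hZ, hX.1, lie_neg], fun Y hY ↦ by
      have hY' : θ ⁅Z, Y⁆ = -⁅Z, Y⁆ := by rw [LieHom.map_lie, hZ, hY, lie_neg]
      have h1 := h.invariant Z X Y hZ
      rw [hX.2 _ hY'] at h1
      rw [killingForm_lie]
      linarith⟩)
  rcases hW with hW | hW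
  · rw [hW, Submodule.mem_bot] at hvW
    exact absurd (Subtype.ext hvW) hv
  · refine ⟨c, ?_, fun X Y hX hY ↦ (hW X hX).2 Y hY⟩
    -- Both forms are positive at `X₀`, hence `c > 0`.
    have h1 := (hW X₀ hX₀').2 X₀ hX₀'
    have h2 : θ X₀ ≠ X₀ := by
      intro h3
      apply hX₀
      rw [← pPart_eq_self hX₀', pPart_apply, h3, sub_self, smul_zero]
    have h3 := h.pos X₀ h2
    rw [h1] at h3
    exact (pos_iff_pos_of_mul_pos h3).2 (h.killingForm_pos hX₀' hX₀)

end IsCartanForm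

end Cartan

/-! ### Metric Lie algebras and their Levi-Civita products. -/

section MetricLieAlgebra

variable {L : Type*} [LieRing L] [LieAlgebra ℝ L]

/-- `U` is the Levi-Civita connection of the left-invariant metric `q`, on left-invariant fields. -/
structure IsAlgebraicLeviCivita (q : LinearMap.BilinForm ℝ L) (U : L → L → L) : Prop where
  torsion (x y : L) : U x y - U y x = ⁅x, y⁆
  metric (x y z : L) : q (U x y) z + q y (U x z) = 0

/-- The Koszul formula determines `q (U x y) z` for every `z`. Linearity of `U` is not required, so
a product obtained by choice can be compared with the connection. -/
lemma IsAlgebraicLeviCivita.unique {q : LinearMap.BilinForm ℝ L} {U U' : L → L → L}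
    (hs : ∀ x y, q x y = q y x) (hp : ∀ x, x ≠ 0 → 0 < q x x)
    (hU : IsAlgebraicLeviCivita q U) (hU' : IsAlgebraicLeviCivita q U') (x y : L) :
    U x y = U' x y := by
  have koszul : ∀ {U : L → L → L}, IsAlgebraicLeviCivita q U → ∀ z,
      2 * q (U x y) z = q ⁅x, y⁆ z - q ⁅y, z⁆ x + q ⁅z, x⁆ y := by
    intro U hU z
    have h1 := hU.metric x y z
    have h2 := hU.metric y z x
    have h3 := hU.metric z x y
    rw [hs y] at h1
    rw [hs z] at h2
    rw [hs x] at h3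
    simp only [← hU.torsion, map_sub, LinearMap.sub_apply]
    linarith
  by_contra hne
  have h := hp _ (sub_ne_zero.2 hne)
  have h1 := koszul hU (U x y - U' x y)
  have h2 := koszul hU' (U x y - U' x y)
  have h3 : q (U x y - U' x y) (U x y - U' x y) =
      q (U x y) (U x y - U' x y) - q (U' x y) (U x y - U' x y) := by
    rw [← LinearMap.sub_apply, ← map_sub]
  linarith

/-- `e` is an orthonormal basis for the form `q`. -/
structure IsOrthonormalBasis (q : LinearMap.BilinForm ℝ L) {ι : Type*} [Fintype ι] (e : ι → L) :
    Prop where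
  sum_eq (x : L) : ∑ i, q x (e i) • e i = x

/-- The expansion of vectors along `e` writes `T` as a sum of rank-one operators. -/
lemma IsOrthonormalBasis.trace_eq {q : LinearMap.BilinForm ℝ L} {ι : Type*} [Fintype ι]
    [FiniteDimensional ℝ L]
    {e : ι → L} (he : IsOrthonormalBasis q e) (T : L →ₗ[ℝ] L) :
    LinearMap.trace ℝ L T = ∑ i, q (T (e i)) (e i) := by
  have h : T = ∑ i, (q.flip (e i)).smulRight (T (e i)) := by
    ext x
    conv_lhs => rw [← he.sum_eq x]
    simp
  conv_lhs => rw [h, map_sum]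
  simp only [LinearMap.trace_smulRight]
  rfl

end MetricLieAlgebra

/-! ### Connection, curvature and Ricci tensor read in `𝔭`. -/

section SymmetricSpaceConnection

variable {L : Type*} [LieRing L] [LieAlgebra ℝ L] {θ : L →ₗ⁅ℝ⁆ L} {Q : LinearMap.BilinForm ℝ L}

namespace IsCartanForm

/-- With `kPart_lie`, the component form of `[𝔨, 𝔭] ⊆ 𝔭` and `[𝔨, 𝔨], [𝔭, 𝔭] ⊆ 𝔨`. -/
lemma pPart_lie (X Y : L) :
    pPart θ ⁅X, Y⁆ = ⁅kPart θ X, pPart θ Y⁆ + ⁅pPart θ X, kPart θ Y⁆ := by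
  simp only [kPart_apply, pPart_apply, LieHom.map_lie, smul_lie, lie_smul, lie_add, add_lie,
    lie_sub, sub_lie]
  module

lemma kPart_lie (X Y : L) :
    kPart θ ⁅X, Y⁆ = ⁅kPart θ X, kPart θ Y⁆ + ⁅pPart θ X, pPart θ Y⁆ := by
  simp only [kPart_apply, pPart_apply, LieHom.map_lie, smul_lie, lie_smul, lie_add, add_lie,
    lie_sub, sub_lie]
  module

variable {𝔟 : Type*} [LieRing 𝔟] [LieAlgebra ℝ 𝔟] {J : 𝔟 →ₗ⁅ℝ⁆ L} {q : LinearMap.BilinForm ℝ 𝔟}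
  {U : 𝔟 → 𝔟 → 𝔟}

/-- The Levi-Civita connection of a simply transitive group of isometries, read in `𝔭`. -/
theorem pPart_connection (h : IsCartanForm θ Q) (hq : ∀ x y, q x y = Q (J x) (J y))
    (hp : ∀ x, x ≠ 0 → 0 < q x x) (hsurj : ∀ X, θ X = -X → ∃ x, pPart θ (J x) = X)
    (hU : IsAlgebraicLeviCivita q U) (x y : 𝔟) :
    pPart θ (J (U x y)) = ⁅kPart θ (J x), pPart θ (J y)⁆ := by
  have hmem : ∀ x y, θ ⁅kPart θ (J x), pPart θ (J y)⁆ = -⁅kPart θ (J x), pPart θ (J y)⁆ := by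
    intro x y
    rw [LieHom.map_lie, h.map_kPart, h.map_pPart, lie_neg]
  choose U' hU' using fun x y ↦ hsurj _ (hmem x y)
  have hs : ∀ x y, q x y = q y x := fun x y ↦ by rw [hq, hq, h.symm]
  have hinj : ∀ x, pPart θ (J x) = 0 → x = 0 := by
    intro x hx
    by_contra hne
    have := hp x hne
    rw [hq, ← h.apply_pPart, hx, map_zero] at this
    exact lt_irrefl _ this
  -- The candidate `[x_𝔨, y_𝔭]` is torsion free by `pPart_lie` and metric by the `𝔨`-invariance of
  -- `Q`; uniqueness identifies it with `U`.
  have hLC : IsAlgebraicLeviCivita q U' := by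
    refine ⟨fun x y ↦ ?_, fun x y z ↦ ?_⟩
    · rw [← sub_eq_zero]
      apply hinj
      rw [map_sub, map_sub, map_sub, map_sub, LieHom.map_lie, pPart_lie, hU', hU',
        ← lie_skew (kPart θ (J y))]
      abel
    · rw [hq, hq, ← h.apply_pPart, ← h.apply_pPart_right (J y), hU', hU',
        ← h.apply_pPart_right _ (J z),
        ← h.apply_pPart (J y)]
      exact h.invariant _ _ _ (h.map_kPart _)
  rw [hU.unique hs hp hLC, hU']

/-- On `𝔭`, `∇_x` is `ad x_𝔨`. The commutator of two of these cancels the part `[x_𝔨, y_𝔨]` of `[x,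
y]_𝔨`, leaving only `[x_𝔭, y_𝔭]`. -/
theorem pPart_curvature (h : IsCartanForm θ Q) (hq : ∀ x y, q x y = Q (J x) (J y))
    (hp : ∀ x, x ≠ 0 → 0 < q x x) (hsurj : ∀ X, θ X = -X → ∃ x, pPart θ (J x) = X)
    (hU : IsAlgebraicLeviCivita q U) (x y z : 𝔟) :
    pPart θ (J (algebraicCurvature U x y z)) =
      -⁅⁅pPart θ (J x), pPart θ (J y)⁆, pPart θ (J z)⁆ := by
  have hc := h.pPart_connection hq hp hsurj hU
  rw [algebraicCurvature, map_sub, map_sub, map_sub, map_sub, hc, hc, hc, hc, hc, LieHom.map_lie,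
    kPart_lie, add_lie, lie_lie (kPart θ (J x))]
  abel

/-- The map `x ↦ pPart θ (J x)` is isometric onto `𝔭`, so it carries `e` to an orthonormal basis of
`𝔭`. -/
lemma pPart_eq_sum (h : IsCartanForm θ Q) (hq : ∀ x y, q x y = Q (J x) (J y))
    (hsurj : ∀ X, θ X = -X → ∃ x, pPart θ (J x) = X) {ι : Type*} [Fintype ι] {e : ι → 𝔟}
    (he : IsOrthonormalBasis q e) (V : L) :
    pPart θ V = ∑ i, Q V (pPart θ (J (e i))) • pPart θ (J (e i)) := by
  obtain ⟨x, hx⟩ := hsurj _ (h.map_pPart V)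
  conv_lhs => rw [← hx, ← he.sum_eq x, map_sum, map_sum]
  refine Finset.sum_congr rfl fun i _ ↦ ?_
  rw [map_smul, map_smul, hq, ← h.apply_pPart V, ← hx, h.apply_pPart, h.apply_pPart_right]

lemma trace_comp_pPart [FiniteDimensional ℝ L]
    (h : IsCartanForm θ Q) (hq : ∀ x y, q x y = Q (J x) (J y))
    (hsurj : ∀ X, θ X = -X → ∃ x, pPart θ (J x) = X) {ι : Type*} [Fintype ι] {e : ι → 𝔟}
    (he : IsOrthonormalBasis q e) (T : L →ₗ[ℝ] L) :
    LinearMap.trace ℝ L (T ∘ₗ pPart θ) =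
      ∑ i, Q (T (pPart θ (J (e i)))) (pPart θ (J (e i))) := by
  have h1 : T ∘ₗ pPart θ =
      ∑ i, (Q.flip (pPart θ (J (e i)))).smulRight (T (pPart θ (J (e i)))) := by
    ext V
    rw [LinearMap.comp_apply, h.pPart_eq_sum hq hsurj he]
    simp
  rw [h1, map_sum]
  simp only [LinearMap.trace_smulRight]
  rfl

/-- The Killing form on `𝔭` as a trace over `𝔭`. -/
lemma killingForm_eq_sum [FiniteDimensional ℝ L]
    (h : IsCartanForm θ Q) (hq : ∀ x y, q x y = Q (J x) (J y))
    (hsurj : ∀ X, θ X = -X → ∃ x, pPart θ (J x) = X) {ι : Type*} [Fintype ι] {e : ι → 𝔟}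
    (he : IsOrthonormalBasis q e) {c : ℝ}
    (hc : ∀ X Y : L, θ X = -X → θ Y = -Y → Q X Y = c * killingForm ℝ L X Y)
    {X Y : L} (hX : θ X = -X) (hY : θ Y = -Y) :
    killingForm ℝ L X Y =
      -2 * c * ∑ i, killingForm ℝ L ⁅Y, pPart θ (J (e i))⁆ ⁅X, pPart θ (J (e i))⁆ := by
  -- For `Y ∈ 𝔭`, `ad Y` exchanges `𝔨` and `𝔭`.
  have hcomm : LieAlgebra.ad ℝ L Y ∘ₗ kPart θ = pPart θ ∘ₗ LieAlgebra.ad ℝ L Y := by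
    ext V
    simp only [LinearMap.comp_apply, LieAlgebra.ad_apply, pPart_lie, kPart_eq_zero hY,
      pPart_eq_self hY, zero_lie, zero_add]
  have hsplit : LieAlgebra.ad ℝ L X ∘ₗ LieAlgebra.ad ℝ L Y =
      LieAlgebra.ad ℝ L X ∘ₗ (pPart θ ∘ₗ LieAlgebra.ad ℝ L Y) +
      (LieAlgebra.ad ℝ L X ∘ₗ LieAlgebra.ad ℝ L Y) ∘ₗ pPart θ := by
    rw [← hcomm]
    ext V
    simp only [LinearMap.add_apply, LinearMap.comp_apply]
    rw [← map_add, ← map_add, kPart_add_pPart]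
  -- Cyclicity turns the trace over `𝔨` into one over `𝔭`; the two equal contributions give the
  -- factor `2`.
  have htrace : LinearMap.trace ℝ L (LieAlgebra.ad ℝ L X ∘ₗ (pPart θ ∘ₗ LieAlgebra.ad ℝ L Y)) =
      LinearMap.trace ℝ L ((LieAlgebra.ad ℝ L Y ∘ₗ LieAlgebra.ad ℝ L X) ∘ₗ pPart θ) := by
    rw [← LinearMap.comp_assoc, LinearMap.trace_comp_comm', LinearMap.comp_assoc]
  have hterm : ∀ {X Y : L}, θ X = -X → θ Y = -Y → ∀ i,
      Q ((LieAlgebra.ad ℝ L X ∘ₗ LieAlgebra.ad ℝ L Y) (pPart θ (J (e i)))) (pPart θ (J (e i))) =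
      -(c * killingForm ℝ L ⁅Y, pPart θ (J (e i))⁆ ⁅X, pPart θ (J (e i))⁆) := by
    intro X Y hX hY i
    have hi := h.map_pPart (J (e i))
    rw [LinearMap.comp_apply, LieAlgebra.ad_apply, LieAlgebra.ad_apply, hc _ _ _ hi,
      killingForm_lie, mul_neg]
    simp [hX, hY, hi]
  rw [killingForm_apply_apply, hsplit, map_add, htrace,
    h.trace_comp_pPart hq hsurj he, h.trace_comp_pPart hq hsurj he, Finset.mul_sum,
    ← Finset.sum_add_distrib]
  refine Finset.sum_congr rfl fun i _ ↦ ?_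
  rw [hterm hX hY, hterm hY hX, killingForm_comm ⁅X, _⁆]
  ring

/-- A simply transitive group of isometries is an Einstein manifold. -/
theorem ricci_eq [FiniteDimensional ℝ L]
    (h : IsCartanForm θ Q) (hq : ∀ x y, q x y = Q (J x) (J y))
    (hp : ∀ x, x ≠ 0 → 0 < q x x) (hsurj : ∀ X, θ X = -X → ∃ x, pPart θ (J x) = X)
    (hU : IsAlgebraicLeviCivita q U) {ι : Type*} [Fintype ι] {e : ι → 𝔟}
    (he : IsOrthonormalBasis q e) {c : ℝ} (hc0 : c ≠ 0)
    (hc : ∀ X Y : L, θ X = -X → θ Y = -Y → Q X Y = c * killingForm ℝ L X Y) (v : 𝔟) :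
    ∑ i, algebraicCurvature U v (e i) (e i) = (-(2 * c)⁻¹) • v := by
  -- By `killingForm_eq_sum` both sides are `-1/2` times the Killing form of the `𝔭`-parts, and `Q =
  -- c B` turns this into the factor `-1/(2c)`.
  have key : ∀ w, q (∑ i, algebraicCurvature U v (e i) (e i)) w = q ((-(2 * c)⁻¹) • v) w := by
    intro w
    have hv := h.map_pPart (J v)
    have hw := h.map_pPart (J w)
    rw [map_smul, LinearMap.smul_apply, smul_eq_mul, hq, hq v, ← h.apply_pPart (J v),
      ← h.apply_pPart_right (pPart θ (J v)) (J w), hc _ _ hv hw, h.killingForm_eq_sum hq hsurj he hc hv hw,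
      map_sum, map_sum, LinearMap.sum_apply, Finset.mul_sum, Finset.mul_sum, Finset.mul_sum]
    refine Finset.sum_congr rfl fun i _ ↦ ?_
    have hi := h.map_pPart (J (e i))
    have hvi : θ ⁅⁅pPart θ (J v), pPart θ (J (e i))⁆, pPart θ (J (e i))⁆ =
        -⁅⁅pPart θ (J v), pPart θ (J (e i))⁆, pPart θ (J (e i))⁆ := by
      simp only [LieHom.map_lie, hv, hi, lie_neg, neg_lie, neg_neg]
    rw [← h.apply_pPart, ← h.apply_pPart_right _ (J w), h.pPart_curvature hq hp hsurj hU, map_neg,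
      LinearMap.neg_apply, hc _ _ hvi hw]
    have h1 : killingForm ℝ L ⁅⁅pPart θ (J v), pPart θ (J (e i))⁆, pPart θ (J (e i))⁆
        (pPart θ (J w)) = -killingForm ℝ L ⁅pPart θ (J w), pPart θ (J (e i))⁆
          ⁅pPart θ (J v), pPart θ (J (e i))⁆ := by
      rw [← lie_skew, map_neg, LinearMap.neg_apply, killingForm_lie, ← lie_skew (pPart θ (J (e i))),
        map_neg, killingForm_comm]
      ring
    rw [h1]
    field_simp
  have hs : ∀ w, q (∑ i, algebraicCurvature U v (e i) (e i) - (-(2 * c)⁻¹) • v) w = 0 := by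
    intro w
    rw [map_sub, LinearMap.sub_apply, key, sub_self]
  by_contra hne
  exact (hp _ (sub_ne_zero.2 hne)).ne' (hs _)

end IsCartanForm

end SymmetricSpaceConnection

/-! ### Gauss equation in codimension one. -/

section Codimension

variable {𝔟 : Type*} [LieRing 𝔟] [LieAlgebra ℝ 𝔟]

namespace IsAlgebraicLeviCivita

variable {q : LinearMap.BilinForm ℝ 𝔟} {U : 𝔟 → 𝔟 → 𝔟}

lemma eq_of_forall_apply_eq (hp : ∀ x, x ≠ 0 → 0 < q x x) {x y : 𝔟}
    (h : ∀ z, q x z = q y z) : x = y := by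
  by_contra hne
  refine (hp _ (sub_ne_zero.2 hne)).ne' ?_
  rw [LinearMap.map_sub₂, h, sub_self]

/-- Linearity in the second variable is not assumed of `U`; metric compatibility forces it. -/
lemma apply_sub_smul (hU : IsAlgebraicLeviCivita q U) (hp : ∀ x, x ≠ 0 → 0 < q x x)
    (x y z : 𝔟) (t : ℝ) : U x (y - t • z) = U x y - t • U x z := by
  refine eq_of_forall_apply_eq hp fun w ↦ ?_
  have h1 := hU.metric x (y - t • z) w
  have h2 := hU.metric x y w
  have h3 := hU.metric x z w
  simp only [map_sub, map_smul, LinearMap.sub_apply, LinearMap.smul_apply, smul_eq_mul] at h1 ⊢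
  linear_combination h1 - h2 + t * h3

variable {𝔰 : Type*} [LieRing 𝔰] [LieAlgebra ℝ 𝔰] {f : 𝔰 →ₗ⁅ℝ⁆ 𝔟}
  {q' : LinearMap.BilinForm ℝ 𝔰} {V : 𝔰 → 𝔰 → 𝔰} {A : 𝔟} {D : 𝔰 →ₗ[ℝ] 𝔰}

lemma apply_normal (hU : IsAlgebraicLeviCivita q U) (hUA : ∀ y, U A y = 0) (x : 𝔟) :
    U x A = -⁅A, x⁆ := by
  have := hU.torsion x A
  rwa [hUA, sub_zero, ← lie_skew] at this

/-- The second fundamental form: `q(∇_x y, A) = -q(y, ∇_x A) = q([A, x], y)`. -/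
lemma apply_apply_normal (hU : IsAlgebraicLeviCivita q U) (hs : ∀ x y, q x y = q y x)
    (hUA : ∀ y, U A y = 0) (hD : ∀ x, f (D x) = ⁅A, f x⁆) (hq' : ∀ x y, q' x y = q (f x) (f y))
    (x y : 𝔰) : q (U (f x) (f y)) A = q' (D x) y := by
  have := hU.metric (f x) (f y) A
  rw [hU.apply_normal hUA, map_neg, hs (f y), ← hD, ← hq'] at this
  linarith

/-- The Gauss formula for an ideal of codimension one with unit normal `A`. -/
theorem map_connection (hU : IsAlgebraicLeviCivita q U) (hV : IsAlgebraicLeviCivita q' V)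
    (hs : ∀ x y, q x y = q y x) (hp : ∀ x, x ≠ 0 → 0 < q x x) (hf : Function.Injective f)
    (hA : q A A = 1) (hmem : ∀ b, q b A = 0 ↔ ∃ x, f x = b)
    (hUA : ∀ y, U A y = 0) (hD : ∀ x, f (D x) = ⁅A, f x⁆) (hq' : ∀ x y, q' x y = q (f x) (f y))
    (x y : 𝔰) : f (V x y) = U (f x) (f y) - q' (D x) y • A := by
  have hn := hU.apply_apply_normal hs hUA hD hq'
  have hex : ∀ x y, ∃ z, f z = U (f x) (f y) - q' (D x) y • A := by
    intro x y
    rw [← hmem, map_sub, LinearMap.sub_apply, hn, map_smul, LinearMap.smul_apply, hA,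
      smul_eq_mul, mul_one, sub_self]
  choose W hW using hex
  have hW' : IsAlgebraicLeviCivita q' W := by
    refine ⟨fun x y ↦ hf ?_, fun x y z ↦ ?_⟩
    · have h1 := hU.torsion (f x) (f y)
      -- Symmetry of the second fundamental form: `[f x, f y]` is tangent, so it has no component
      -- along `A`.
      have h2 : q' (D x) y = q' (D y) x := by
        rw [← hn, ← hn, ← sub_eq_zero, ← LinearMap.sub_apply, ← map_sub, h1, ← LieHom.map_lie]
        exact (hmem _).2 ⟨_, rfl⟩
      rw [map_sub, hW, hW, LieHom.map_lie, ← h1, h2]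
      abel
    · have hz : ∀ z, q (f z) A = 0 := fun z ↦ (hmem _).2 ⟨z, rfl⟩
      have := hU.metric (f x) (f y) (f z)
      rw [hq', hq', hW, hW]
      simp only [map_sub, map_smul, LinearMap.sub_apply, LinearMap.smul_apply, hz, hs A, smul_zero,
        sub_zero]
      exact this
  rw [hV.unique (fun x y ↦ by rw [hq', hq', hs])
    (fun x hx ↦ by rw [hq']; exact hp _ (fun h0 ↦ hx (hf (h0.trans (map_zero f).symm)))) hW', hW]

/-- The Gauss equation for an ideal of codimension one with unit normal `A`. -/
theorem exists_map_curvature (hU : IsAlgebraicLeviCivita q U) (hV : IsAlgebraicLeviCivita q' V)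
    (hs : ∀ x y, q x y = q y x) (hp : ∀ x, x ≠ 0 → 0 < q x x) (hf : Function.Injective f)
    (hA : q A A = 1) (hmem : ∀ b, q b A = 0 ↔ ∃ x, f x = b)
    (hUA : ∀ y, U A y = 0) (hD : ∀ x, f (D x) = ⁅A, f x⁆) (hq' : ∀ x y, q' x y = q (f x) (f y))
    (x y z : 𝔰) : ∃ t : ℝ, f (algebraicCurvature V x y z) =
      algebraicCurvature U (f x) (f y) (f z) + q' (D y) z • f (D x) - q' (D x) z • f (D y) +
        t • A := by
  have h := hU.map_connection hV hs hp hf hA hmem hUA hD hq'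
  -- The normal terms left by the Gauss formula; only their being multiples of `A` matters later.
  refine ⟨-q' (D x) (V y z) + q' (D y) (V x z) + q' (D ⁅x, y⁆) z, ?_⟩
  rw [algebraicCurvature, map_sub, map_sub, h x (V y z), h y z, h y (V x z), h x z, h ⁅x, y⁆, hU.apply_sub_smul hp,
    hU.apply_sub_smul hp, hU.apply_normal hUA, hU.apply_normal hUA, algebraicCurvature, hD, hD,
    LieHom.map_lie]
  module

/-- An ideal of codimension one in an Einstein metric Lie algebra whose unit normal is parallel
along itself. -/
theorem ricci_codimension_one [FiniteDimensional ℝ 𝔰]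
    (hU : IsAlgebraicLeviCivita q U) (hV : IsAlgebraicLeviCivita q' V)
    (hs : ∀ x y, q x y = q y x) (hp : ∀ x, x ≠ 0 → 0 < q x x) (hf : Function.Injective f)
    (hA : q A A = 1) (hmem : ∀ b, q b A = 0 ↔ ∃ x, f x = b)
    (hUA : ∀ y, U A y = 0) (hD : ∀ x, f (D x) = ⁅A, f x⁆) (hq' : ∀ x y, q' x y = q (f x) (f y))
    {ι : Type*} [Fintype ι] {e : ι → 𝔰} (he : IsOrthonormalBasis q' e) {k : ℝ}
    (hk : ∀ e : Option ι → 𝔟, IsOrthonormalBasis q e →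
      ∀ v, ∑ i, algebraicCurvature U v (e i) (e i) = k • v) (v : 𝔰) :
    ∑ i, algebraicCurvature V v (e i) (e i) = k • v + LinearMap.trace ℝ 𝔰 D • D v := by
  have hz : ∀ z, q (f z) A = 0 := fun z ↦ (hmem _).2 ⟨z, rfl⟩
  -- The basis of `𝔰` completed by the normal `A`, placed at `none`.
  let b : Option ι → 𝔟 := fun o ↦ o.elim A (fun i ↦ f (e i))
  have hb : IsOrthonormalBasis q b := by
    refine ⟨fun x ↦ ?_⟩
    obtain ⟨z, hx⟩ : ∃ z, f z = x - q x A • A := by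
      rw [← hmem, map_sub, LinearMap.sub_apply, map_smul, LinearMap.smul_apply, hA,
        smul_eq_mul, mul_one, sub_self]
    have hx' : x = f z + q x A • A := by rw [hx, sub_add_cancel]
    have hsum : ∑ i, q x (f (e i)) • f (e i) = f z := by
      conv_rhs => rw [← he.sum_eq z, map_sum]
      refine Finset.sum_congr rfl fun i _ ↦ ?_
      rw [map_smul, hq', hx', map_add, map_smul, LinearMap.add_apply, LinearMap.smul_apply, hs A,
        hz, smul_zero, add_zero]
    rw [Fintype.sum_option]
    simp only [b, Option.elim]
    rw [hsum, hx]
    abel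
  have hric := hk b hb (f v)
  rw [Fintype.sum_option] at hric
  -- Since `∇_A = 0`, only `-∇_{[v, A]} A` survives. This term cancels the `D²` produced by the
  -- Gauss equation in `hDD`.
  have hnormal : algebraicCurvature U (f v) A A = -f (D (D v)) := by
    have h0 : U (f v) 0 = 0 := by
      have := hU.apply_sub_smul hp (f v) 0 0 1
      simpa using this
    rw [algebraicCurvature, hUA, hUA, h0, hU.apply_normal hUA, hD, hD, ← lie_skew A (f v), lie_neg]
    abel
  simp only [b, Option.elim, hnormal] at hric
  choose t ht using fun i ↦
    hU.exists_map_curvature hV hs hp hf hA hmem hUA hD hq' v (e i) (e i)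
  have hDD : ∑ i, q' (D v) (e i) • f (D (e i)) = f (D (D v)) := by
    conv_rhs => rw [← he.sum_eq (D v)]
    simp only [map_sum, map_smul]
  have hsum : f (∑ i, algebraicCurvature V v (e i) (e i)) =
      f (k • v + LinearMap.trace ℝ 𝔰 D • D v) + (∑ i, t i) • A := by
    rw [map_sum]
    simp only [ht]
    rw [Finset.sum_add_distrib, Finset.sum_sub_distrib, Finset.sum_add_distrib, hDD,
      ← Finset.sum_smul, ← Finset.sum_smul, ← he.trace_eq, map_add, map_smul, map_smul, ← hric]
    abel
  -- Pairing with `A` kills every tangent term.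
  have ht0 : ∑ i, t i = 0 := by
    have := congrArg (fun x ↦ q x A) hsum
    simpa only [map_add, LinearMap.add_apply, hz, map_smul, LinearMap.smul_apply, hA, zero_add,
      smul_eq_mul, mul_one, mul_zero, eq_comm] using this
  apply hf
  rw [hsum, ht0, zero_smul, add_zero]

end IsAlgebraicLeviCivita

end Codimension

/-! ### Positivity and heights. -/

section Positivity

variable {V : Type*} [AddCommGroup V] [Module ℝ V] {P : Set V}

/-- Otherwise `v` and `-v` would both be positive. The axioms leave open whether `0 ∈ P`, which is
why `v ≠ 0` is needed. -/
lemma IsPositivity.add_ne_zero (hP : IsPositivity P) {v w : V} (hv : v ∈ P) (hw : w ∈ P)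
    (h0 : v ≠ 0) : v + w ≠ 0 := by
  intro h
  rw [← neg_eq_of_add_eq_zero_right h] at hw
  rcases hP.xor v h0 with h1 | h1
  · exact h1.2 hw
  · exact h1.2 hv

/-- The elements of `R` which are strictly below `v`. -/
def strictlyBelow (P R : Set V) (v : V) : Set V := {w ∈ R | v - w ∈ P ∧ v ≠ w}

/-- Whatever lies below `v` lies below `v + w`, and `v` itself is new. -/
lemma IsPositivity.ncard_strictlyBelow_lt (hP : IsPositivity P) {R : Set V} (hR : R.Finite)
    {v w : V} (hv : v ∈ R) (hw : w ∈ P) (h0 : w ≠ 0) :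
    (strictlyBelow P R v).ncard < (strictlyBelow P R (v + w)).ncard := by
  refine Set.ncard_lt_ncard ⟨?_, fun h ↦ ?_⟩ (hR.subset fun _ h ↦ h.1)
  · rintro u ⟨hu, h1, h2⟩
    have h3 : v + w - u = w + (v - u) := by abel
    refine ⟨hu, h3 ▸ hP.add _ hw _ h1, fun h4 ↦ ?_⟩
    exact hP.add_ne_zero hw h1 h0 (by rw [← h3, h4, sub_self])
  · exact (h ⟨hv, by rwa [add_sub_cancel_left], by simpa using h0⟩).2.2 rfl

end Positivity

/-! ### Root spaces and solvability. -/

section WeightSpaces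

variable {L : Type*} [LieRing L] [LieAlgebra ℝ L]

/-- The simultaneous eigenspace of `ad A`, `A ∈ 𝔞`, with eigenvalues `l A`. -/
def dualWeightSpace (𝔞 : Submodule ℝ L) (l : Module.Dual ℝ 𝔞) : Submodule ℝ L where
  carrier := {X | ∀ A : 𝔞, ⁅(A : L), X⁆ = l A • X}
  add_mem' hX hY A := by rw [lie_add, hX A, hY A, smul_add]
  zero_mem' A := by simp
  smul_mem' c X hX A := by rw [lie_smul, hX A, smul_comm]

/-- The set of positive restricted roots. -/
def positiveRoots (𝔞 : Submodule ℝ L) (P : Set (Module.Dual ℝ 𝔞)) : Set (Module.Dual ℝ 𝔞) :=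
  {l | l ≠ 0 ∧ dualWeightSpace 𝔞 l ≠ ⊥} ∩ P

/-- The sum of the root spaces of the roots in `R`. -/
def sumWeightSpaces (𝔞 : Submodule ℝ L) (R : Set (Module.Dual ℝ 𝔞)) : Submodule ℝ L :=
  ⨆ l ∈ R, dualWeightSpace 𝔞 l

variable {𝔞 : Submodule ℝ L} {P R R' : Set (Module.Dual ℝ 𝔞)}

lemma le_sumWeightSpaces {l : Module.Dual ℝ 𝔞} (hl : l ∈ R) :
    dualWeightSpace 𝔞 l ≤ sumWeightSpaces 𝔞 R := le_iSup₂ (f := fun l _ ↦ dualWeightSpace 𝔞 l) l hl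

lemma sumWeightSpaces_mono (h : R ⊆ R') : sumWeightSpaces 𝔞 R ≤ sumWeightSpaces 𝔞 R' :=
  biSup_mono h

lemma lie_mem_dualWeightSpace {l m : Module.Dual ℝ 𝔞} {X Y : L} (hX : X ∈ dualWeightSpace 𝔞 l)
    (hY : Y ∈ dualWeightSpace 𝔞 m) : ⁅X, Y⁆ ∈ dualWeightSpace 𝔞 (l + m) := by
  intro A
  rw [leibniz_lie, hX A, hY A, smul_lie, lie_smul, LinearMap.add_apply, add_smul]

lemma lie_mem_of_mem_sumWeightSpaces {W : Submodule ℝ L}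
    (h : ∀ l ∈ R, ∀ m ∈ R, ∀ X ∈ dualWeightSpace 𝔞 l, ∀ Y ∈ dualWeightSpace 𝔞 m, ⁅X, Y⁆ ∈ W)
    {X Y : L} (hX : X ∈ sumWeightSpaces 𝔞 R) (hY : Y ∈ sumWeightSpaces 𝔞 R) : ⁅X, Y⁆ ∈ W := by
  have h1 : ∀ l ∈ R, ∀ X ∈ dualWeightSpace 𝔞 l, ⁅X, Y⁆ ∈ W := by
    intro l hl X hX
    have : sumWeightSpaces 𝔞 R ≤ W.comap (LieAlgebra.ad ℝ L X) :=
      iSup₂_le fun m hm Y hY ↦ h l hl m hm X hX Y hY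
    exact this hY
  have : sumWeightSpaces 𝔞 R ≤ W.comap (LieAlgebra.ad ℝ L Y) := by
    refine iSup₂_le fun l hl X hX ↦ ?_
    rw [Submodule.mem_comap, LieAlgebra.ad_apply, ← lie_skew]
    exact W.neg_mem (h1 l hl X hX)
  have h2 := this hX
  rw [Submodule.mem_comap, LieAlgebra.ad_apply, ← lie_skew] at h2
  exact W.neg_mem_iff.1 h2

lemma lie_mem_sumWeightSpaces {A X : L} (hA : A ∈ 𝔞) (hX : X ∈ sumWeightSpaces 𝔞 R) :
    ⁅A, X⁆ ∈ sumWeightSpaces 𝔞 R := by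
  have : sumWeightSpaces 𝔞 R ≤ (sumWeightSpaces 𝔞 R).comap (LieAlgebra.ad ℝ L A) := by
    refine iSup₂_le fun l hl X hX ↦ ?_
    have h1 : ⁅A, X⁆ = l ⟨A, hA⟩ • X := hX ⟨A, hA⟩
    rw [Submodule.mem_comap, LieAlgebra.ad_apply, h1]
    exact Submodule.smul_mem _ _ (le_sumWeightSpaces hl hX)
  exact this hX

/-- Roots are weights of the abelian algebra `𝔞` acting on `L`, and a finite-dimensional module has
finitely many weights. -/
lemma finite_positiveRoots [FiniteDimensional ℝ L] (h𝔞 : ∀ X ∈ 𝔞, ∀ Y ∈ 𝔞, ⁅X, Y⁆ = 0) :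
    (positiveRoots 𝔞 P).Finite := by
  let K : LieSubalgebra ℝ L :=
    { 𝔞 with
      lie_mem' := fun {X Y} hX hY ↦ by
        rw [h𝔞 X hX Y hY]
        exact 𝔞.zero_mem }
  have hK : IsLieAbelian K := ⟨fun X Y ↦ Subtype.ext (h𝔞 X X.2 Y Y.2)⟩
  have hfin := LieModule.finite_genWeightSpace_ne_bot ℝ K L
  refine Set.Finite.of_finite_image (f := fun l : Module.Dual ℝ 𝔞 ↦ (l : K → ℝ)) (hfin.subset ?_)
    (DFunLike.coe_injective.injOn)
  rintro _ ⟨l, ⟨⟨-, hl⟩, -⟩, rfl⟩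
  obtain ⟨X, hX, hX0⟩ := Submodule.exists_mem_ne_zero_of_ne_bot hl
  have hw : X ∈ LieModule.weightSpace L (fun A : K ↦ l A) :=
    (LieModule.mem_weightSpace _ X).2 hX
  intro hbot
  have := LieModule.weightSpace_le_genWeightSpace L _ hw
  rw [hbot] at this
  exact hX0 this

/-- The filtration of the nilpotent part by the height of the roots. -/
def rootFiltration (𝔞 : Submodule ℝ L) (P : Set (Module.Dual ℝ 𝔞)) (k : ℕ) : Submodule ℝ L :=
  sumWeightSpaces 𝔞
    {l ∈ positiveRoots 𝔞 P | k ≤ (strictlyBelow P (positiveRoots 𝔞 P) l).ncard}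

lemma rootFiltration_zero : rootFiltration 𝔞 P 0 = sumWeightSpaces 𝔞 (positiveRoots 𝔞 P) := by
  simp [rootFiltration]

lemma rootFiltration_le (k : ℕ) :
    rootFiltration 𝔞 P k ≤ sumWeightSpaces 𝔞 (positiveRoots 𝔞 P) :=
  sumWeightSpaces_mono fun _ h ↦ h.1

lemma exists_rootFiltration_eq_bot (hR : (positiveRoots 𝔞 P).Finite) :
    ∃ k, rootFiltration 𝔞 P k = ⊥ := by
  refine ⟨(positiveRoots 𝔞 P).ncard + 1, ?_⟩
  rw [rootFiltration, sumWeightSpaces, eq_bot_iff]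
  refine iSup₂_le fun l hl ↦ ?_
  have := Set.ncard_le_ncard (s := strictlyBelow P (positiveRoots 𝔞 P) l) (fun _ h ↦ h.1) hR
  have := hl.2
  omega

/-- A nonzero bracket of root vectors for `l` and `m` has the root `l + m`, which is strictly higher
than `l`. -/
lemma lie_mem_rootFiltration (hP : IsPositivity P) (hR : (positiveRoots 𝔞 P).Finite) {k : ℕ}
    {X Y : L} (hX : X ∈ rootFiltration 𝔞 P k) (hY : Y ∈ rootFiltration 𝔞 P k) :
    ⁅X, Y⁆ ∈ rootFiltration 𝔞 P (k + 1) := by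
  refine lie_mem_of_mem_sumWeightSpaces ?_ hX hY
  intro l hl m hm X hX Y hY
  by_cases h0 : ⁅X, Y⁆ = 0
  · rw [h0]
    exact Submodule.zero_mem _
  · have h1 := lie_mem_dualWeightSpace hX hY
    have h2 := hP.ncard_strictlyBelow_lt hR hl.1 hm.1.2 hm.1.1.1
    exact le_sumWeightSpaces (R := {l ∈ positiveRoots 𝔞 P |
      k + 1 ≤ (strictlyBelow P (positiveRoots 𝔞 P) l).ncard})
      ⟨⟨⟨hP.add_ne_zero hl.1.2 hm.1.2 hl.1.1.1, (Submodule.ne_bot_iff _).2 ⟨_, h1, h0⟩⟩,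
        hP.add _ hl.1.2 _ hm.1.2⟩, hl.2.trans_lt h2⟩ h1

/-- The derived algebra of `𝔞 ⊕ 𝔫` is contained in `𝔫`. -/
lemma lie_mem_of_mem_sup (hP : IsPositivity P) (h𝔞 : ∀ X ∈ 𝔞, ∀ Y ∈ 𝔞, ⁅X, Y⁆ = 0)
    (hR : (positiveRoots 𝔞 P).Finite) {X Y : L}
    (hX : X ∈ 𝔞 ⊔ sumWeightSpaces 𝔞 (positiveRoots 𝔞 P))
    (hY : Y ∈ 𝔞 ⊔ sumWeightSpaces 𝔞 (positiveRoots 𝔞 P)) :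
    ⁅X, Y⁆ ∈ sumWeightSpaces 𝔞 (positiveRoots 𝔞 P) := by
  obtain ⟨A, hA, N, hN, rfl⟩ := Submodule.mem_sup.1 hX
  obtain ⟨A', hA', N', hN', rfl⟩ := Submodule.mem_sup.1 hY
  rw [lie_add, add_lie, add_lie, h𝔞 A hA A' hA', zero_add, ← lie_skew N A']
  refine Submodule.add_mem _ (Submodule.neg_mem _ (lie_mem_sumWeightSpaces hA' hN))
    (Submodule.add_mem _ (lie_mem_sumWeightSpaces hA hN') ?_)
  rw [← rootFiltration_zero] at hN hN'
  exact rootFiltration_le _ (lie_mem_rootFiltration hP hR hN hN')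

lemma map_mem_of_mem_lie {𝔰 : Type*} [LieRing 𝔰] [LieAlgebra ℝ 𝔰] (f : 𝔰 →ₗ⁅ℝ⁆ L)
    {I : LieIdeal ℝ 𝔰} {V W : Submodule ℝ L} (hI : ∀ x ∈ I, f x ∈ V)
    (hV : ∀ X ∈ V, ∀ Y ∈ V, ⁅X, Y⁆ ∈ W) {x : 𝔰} (hx : x ∈ ⁅I, I⁆) : f x ∈ W := by
  rw [← LieSubmodule.mem_toSubmodule, LieSubmodule.lieIdeal_oper_eq_linear_span'] at hx
  have : Submodule.span ℝ {z | ∃ x ∈ I, ∃ y ∈ I, ⁅x, y⁆ = z} ≤ W.comap f.toLinearMap := by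
    rw [Submodule.span_le]
    rintro _ ⟨x, hx, y, hy, rfl⟩
    change f ⁅x, y⁆ ∈ W
    rw [LieHom.map_lie]
    exact hV _ (hI x hx) _ (hI y hy)
  exact this hx

/-- A Lie algebra that embeds in `𝔞 ⊕ 𝔫` is solvable. -/
theorem isSolvable_of_mem_sup [FiniteDimensional ℝ L] (hP : IsPositivity P)
    (h𝔞 : ∀ X ∈ 𝔞, ∀ Y ∈ 𝔞, ⁅X, Y⁆ = 0)
    {𝔰 : Type*} [LieRing 𝔰] [LieAlgebra ℝ 𝔰] (f : 𝔰 →ₗ⁅ℝ⁆ L) (hf : Function.Injective f)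
    (hmem : ∀ x, f x ∈ 𝔞 ⊔ sumWeightSpaces 𝔞 (positiveRoots 𝔞 P)) : LieAlgebra.IsSolvable 𝔰 := by
  have hR := finite_positiveRoots (P := P) h𝔞
  -- The shift by one accounts for the first derivation, which only passes from `𝔞 ⊕ 𝔫` to `𝔫`, step
  -- `0` of the filtration.
  have hder : ∀ k, ∀ x ∈ LieAlgebra.derivedSeries ℝ 𝔰 (k + 1), f x ∈ rootFiltration 𝔞 P k := by
    intro k
    induction k with
    | zero =>
      intro x hx
      rw [LieAlgebra.derivedSeries_def, LieAlgebra.derivedSeriesOfIdeal_succ] at hx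
      rw [rootFiltration_zero]
      exact map_mem_of_mem_lie f (fun x _ ↦ hmem x)
        (fun X hX Y hY ↦ lie_mem_of_mem_sup hP h𝔞 hR hX hY) hx
    | succ k ih =>
      intro x hx
      rw [LieAlgebra.derivedSeries_def, LieAlgebra.derivedSeriesOfIdeal_succ] at hx
      exact map_mem_of_mem_lie f ih (fun X hX Y hY ↦ lie_mem_rootFiltration hP hR hX hY) hx
  obtain ⟨k, hk⟩ := exists_rootFiltration_eq_bot hR
  refine LieAlgebra.IsSolvable.mk (R := ℝ) (k := k + 1) ?_
  rw [LieSubmodule.eq_bot_iff]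
  intro x hx
  have := hder k x hx
  rw [hk, Submodule.mem_bot] at this
  exact hf (this.trans (map_zero f).symm)

end WeightSpaces

/-! ### Projection of `𝔞 ⊕ 𝔫` onto `𝔭`, and orthogonality of `𝔞` and `𝔫`. -/

section Iwasawa

variable {L : Type*} [LieRing L] [LieAlgebra ℝ L] {θ : L →ₗ⁅ℝ⁆ L}
  {Q : LinearMap.BilinForm ℝ L} {𝔞 : Submodule ℝ L} {P : Set (Module.Dual ℝ 𝔞)}

lemma map_mem_dualWeightSpace (h𝔞 : ∀ X ∈ 𝔞, θ X = -X)
    {l : Module.Dual ℝ 𝔞} {X : L} (hX : X ∈ dualWeightSpace 𝔞 l) :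
    θ X ∈ dualWeightSpace 𝔞 (-l) := by
  intro A
  have h1 : θ ⁅(A : L), X⁆ = θ (l A • X) := congrArg θ (hX A)
  rw [LieHom.map_lie, h𝔞 A A.2, neg_lie, map_smul] at h1
  rw [LinearMap.neg_apply, neg_smul, ← h1, neg_neg]

namespace IsCartanForm

/-- Every element of `𝔭` is the `𝔭`-part of an element of `𝔞 ⊕ 𝔫`. -/
theorem exists_mem_sup_pPart_eq [FiniteDimensional ℝ L] (h : IsCartanForm θ Q) (hP : IsPositivity P)
    (h𝔞 : ∀ X ∈ 𝔞, θ X = -X) (hab : ∀ X ∈ 𝔞, ∀ Y ∈ 𝔞, ⁅X, Y⁆ = 0)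
    (hmax : ∀ X, θ X = -X → (∀ A ∈ 𝔞, ⁅A, X⁆ = 0) → X ∈ 𝔞) (X : L) :
    ∃ Y ∈ 𝔞 ⊔ sumWeightSpaces 𝔞 (positiveRoots 𝔞 P), pPart θ Y = pPart θ X := by
  let W : Submodule ℝ L :=
    ((𝔞 ⊔ sumWeightSpaces 𝔞 (positiveRoots 𝔞 P)).map (pPart θ)).comap (pPart θ)
  suffices hW : W = ⊤ by
    have : X ∈ W := hW ▸ Submodule.mem_top
    exact this
  -- For this positive definite form, `ad A` with `A ∈ 𝔭` is symmetric, so `L` is spanned by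
  -- simultaneous eigenvectors of `ad 𝔞` and these suffice.
  let B : LinearMap.BilinForm ℝ L := -(killingForm ℝ L).comp θ.toLinearMap LinearMap.id
  have hB : ∀ X Y, B X Y = -killingForm ℝ L (θ X) Y := fun _ _ ↦ rfl
  have htop := iSup_iInf_eigenspace_eq_top (B := B)
    (fun X Y ↦ by rw [hB, hB, h.killingForm_map_left, killingForm_comm]) (fun X hX ↦ h.cartan X hX)
    (T := fun A : 𝔞 ↦ LieAlgebra.ad ℝ L (A : L))
    (fun A X Y ↦ by
      rw [hB, hB, LieAlgebra.ad_apply, LieAlgebra.ad_apply, LieHom.map_lie, h𝔞 A A.2, neg_lie,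
        map_neg, LinearMap.neg_apply, killingForm_lie, neg_neg])
    (fun A A' ↦ by
      ext X
      have := leibniz_lie (A : L) (A' : L) X
      rwa [hab A A.2 A' A'.2, zero_lie, zero_add] at this)
  rw [eq_top_iff, ← htop]
  refine iSup_le fun χ X hX ↦ ?_
  rcases eq_or_ne X 0 with rfl | h0
  · exact W.zero_mem
  have hχ : ∀ A : 𝔞, ⁅(A : L), X⁆ = χ A • X := fun A ↦
    Module.End.mem_eigenspace_iff.1 ((Submodule.mem_iInf _).1 hX A)
  let l : Module.Dual ℝ 𝔞 :=
    { toFun := χ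
      map_add' := fun A A' ↦ smul_left_injective ℝ h0 (by
        change χ (A + A') • X = (χ A + χ A') • X
        rw [add_smul, ← hχ, ← hχ, ← hχ, Submodule.coe_add, add_lie])
      map_smul' := fun c A ↦ smul_left_injective ℝ h0 (by
        change χ (c • A) • X = (c * χ A) • X
        rw [mul_smul, ← hχ, ← hχ, Submodule.coe_smul, smul_lie]) }
  have hl : X ∈ dualWeightSpace 𝔞 l := hχ
  -- Weight zero: the `𝔭`-part of `X` centralizes `𝔞`, so it lies in `𝔞` by maximality.
  by_cases hl0 : l = 0
  · have hcomm : ∀ A ∈ 𝔞, ⁅A, X⁆ = 0 := by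
      intro A hA
      have := hl ⟨A, hA⟩
      rwa [hl0, LinearMap.zero_apply, zero_smul] at this
    have hcomm' : ∀ A ∈ 𝔞, ⁅A, pPart θ X⁆ = 0 := by
      intro A hA
      have h1 := pPart_lie (θ := θ) A X
      have h2 : kPart θ ⁅A, X⁆ = _ := kPart_lie (θ := θ) A X
      rw [hcomm A hA, map_zero, kPart_eq_zero (h𝔞 A hA), pPart_eq_self (h𝔞 A hA), zero_lie,
        zero_add] at h2
      exact h2.symm
    exact ⟨pPart θ X, Submodule.mem_sup_left (hmax _ (h.map_pPart X) hcomm'),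
      pPart_eq_self (h.map_pPart X)⟩
  · rcases hP.xor l hl0 with hP' | hP'
    · exact ⟨X, Submodule.mem_sup_right (le_sumWeightSpaces
        (R := positiveRoots 𝔞 P) ⟨⟨hl0, (Submodule.ne_bot_iff _).2 ⟨X, hl, h0⟩⟩, hP'.1⟩ hl), rfl⟩
    -- Negative root: `-θ X` has the opposite, positive root and the same `𝔭`-part as `X`.
    · have hθ := map_mem_dualWeightSpace h𝔞 hl
      have hθ0 : θ X ≠ 0 := fun h1 ↦ h0 (by rw [← h.involutive X, h1, map_zero])
      refine ⟨-θ X, Submodule.neg_mem _ (Submodule.mem_sup_right (le_sumWeightSpaces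
        (R := positiveRoots 𝔞 P) ⟨⟨neg_ne_zero.2 hl0, (Submodule.ne_bot_iff _).2 ⟨_, hθ, hθ0⟩⟩, hP'.1⟩ hθ)), ?_⟩
      rw [map_neg, pPart_apply, pPart_apply, h.involutive, ← smul_neg, neg_sub]

/-- `𝔞` and `𝔫` are orthogonal. -/
theorem apply_eq_zero_of_mem_sumWeightSpaces [FiniteDimensional ℝ L] (h : IsCartanForm θ Q)
    (h𝔞 : ∀ X ∈ 𝔞, θ X = -X) (hab : ∀ X ∈ 𝔞, ∀ Y ∈ 𝔞, ⁅X, Y⁆ = 0)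
    {A X : L} (hA : A ∈ 𝔞) (hX : X ∈ sumWeightSpaces 𝔞 (positiveRoots 𝔞 P)) : Q X A = 0 := by
  obtain ⟨c, -, hc⟩ := h.exists_eq_killingForm
  have : sumWeightSpaces 𝔞 (positiveRoots 𝔞 P) ≤ LinearMap.ker (Q.flip A) := by
    refine iSup₂_le fun l hl X hX ↦ ?_
    rw [LinearMap.mem_ker]
    change Q X A = 0
    have hzero : killingForm ℝ L X A = 0 := by
      -- Invariance gives `l(A') B(X, A) = B([A', X], A) = -B(X, [A', A]) = 0`.
      obtain ⟨A', hA'⟩ : ∃ A', l A' ≠ 0 := by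
        by_contra! hne
        exact hl.1.1 (LinearMap.ext hne)
      have h1 := killingForm_lie (A' : L) X A
      rw [hX A', hab A' A'.2 A hA, map_zero, neg_zero, map_smul, LinearMap.smul_apply,
        smul_eq_mul] at h1
      exact (mul_eq_zero.1 h1).resolve_left hA'
    rw [← h.apply_pPart, hc _ _ (h.map_pPart X) (h𝔞 A hA), pPart_apply, map_smul, map_sub,
      LinearMap.smul_apply, LinearMap.sub_apply, h.killingForm_map_left, h𝔞 A hA, map_neg, hzero]
    simp
  exact this hX

end IsCartanForm

end Iwasawa

/-! ### The Ricci operators of `𝔞 ⊕ 𝔫` and `𝔰`. -/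

section IwasawaCodimensionOne

variable {L : Type*} [LieRing L] [LieAlgebra ℝ L] [FiniteDimensional ℝ L] {θ : L →ₗ⁅ℝ⁆ L}
  {Q : LinearMap.BilinForm ℝ L} {𝔞 : Submodule ℝ L} {P : Set (Module.Dual ℝ 𝔞)}
  {𝔟 : Type*} [LieRing 𝔟] [LieAlgebra ℝ 𝔟] {J : 𝔟 →ₗ⁅ℝ⁆ L}
  {𝔰 : Type*} [LieRing 𝔰] [LieAlgebra ℝ 𝔰] {f : 𝔰 →ₗ⁅ℝ⁆ 𝔟}

/-- The restriction of `ad A` to a subalgebra which it maps to itself. -/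
lemma exists_lieDerivation_of_lie_mem_range (hf : Function.Injective f) {A : 𝔟}
    (h : ∀ x, ∃ y, f y = ⁅A, f x⁆) :
    ∃ D : LieDerivation ℝ 𝔰 𝔰, ∀ x, f (D x) = ⁅A, f x⁆ := by
  choose D hD using h
  let D' : 𝔰 →ₗ[ℝ] 𝔰 :=
    { toFun := D
      map_add' := fun x y ↦ hf (by rw [hD, map_add, map_add, hD, hD, lie_add])
      map_smul' := fun c x ↦ hf (by rw [hD, map_smul, map_smul, hD, lie_smul, RingHom.id_apply]) }
  refine ⟨⟨D', fun x y ↦ hf ?_⟩, hD⟩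
  change f (D ⁅x, y⁆) = f (⁅x, D y⁆ - ⁅y, D x⁆)
  rw [hD, map_sub, LieHom.map_lie, LieHom.map_lie, LieHom.map_lie, hD, hD, leibniz_lie,
    ← lie_skew (f y)]
  abel

/-- The Ricci operators of the solvable part of an Iwasawa decomposition and of its subalgebra
`(𝔞 ⊖ ℝ H) ⊕ 𝔫`. -/
theorem IsCartanForm.exists_ricci_codimension_one [FiniteDimensional ℝ 𝔰] (h : IsCartanForm θ Q)
    (hP : IsPositivity P) (h𝔞 : ∀ X ∈ 𝔞, θ X = -X) (hab : ∀ X ∈ 𝔞, ∀ Y ∈ 𝔞, ⁅X, Y⁆ = 0)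
    (hmax : ∀ X, θ X = -X → (∀ A ∈ 𝔞, ⁅A, X⁆ = 0) → X ∈ 𝔞)
    (hJ : ∀ X, X ∈ 𝔞 ⊔ sumWeightSpaces 𝔞 (positiveRoots 𝔞 P) ↔ ∃ b, J b = X)
    {q : LinearMap.BilinForm ℝ 𝔟} (hq : ∀ x y, q x y = Q (J x) (J y))
    (hqp : ∀ x, x ≠ 0 → 0 < q x x) {U : 𝔟 → 𝔟 → 𝔟} (hU : IsAlgebraicLeviCivita q U)
    {H : L} (hH : H ∈ 𝔞) (hHH : Q H H = 1) (hfi : Function.Injective f)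
    (hf : ∀ b, (∃ x, f x = b) ↔
      ∃ X, (X ∈ 𝔞 ∧ Q X H = 0) ∧ ∃ N ∈ sumWeightSpaces 𝔞 (positiveRoots 𝔞 P), X + N = J b)
    {q' : LinearMap.BilinForm ℝ 𝔰} (hq' : ∀ x y, q' x y = q (f x) (f y))
    {V : 𝔰 → 𝔰 → 𝔰} (hV : IsAlgebraicLeviCivita q' V)
    {ι : Type*} [Fintype ι] {e : ι → 𝔟} (he : IsOrthonormalBasis q e)
    {ι' : Type*} [Fintype ι'] {e' : ι' → 𝔰} (he' : IsOrthonormalBasis q' e') :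
    ∃ k : ℝ, k < 0 ∧ (∀ v, ∑ i, algebraicCurvature U v (e i) (e i) = k • v) ∧
      ∃ D : LieDerivation ℝ 𝔰 𝔰, (∀ v, J (f (D v)) = ⁅H, J (f v)⁆) ∧
        ∀ v, ∑ i, algebraicCurvature V v (e' i) (e' i) =
          k • v + LinearMap.trace ℝ 𝔰 D.toLinearMap • D v := by
  obtain ⟨c, hc0, hc⟩ := h.exists_eq_killingForm
  have hsurj : ∀ X, θ X = -X → ∃ x, pPart θ (J x) = X := by
    intro X hX
    obtain ⟨Y, hY, hYX⟩ := h.exists_mem_sup_pPart_eq hP h𝔞 hab hmax X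
    obtain ⟨b, rfl⟩ := (hJ Y).1 hY
    exact ⟨b, hYX.trans (pPart_eq_self hX)⟩
  have hs : ∀ x y, q x y = q y x := fun x y ↦ by rw [hq, hq, h.symm]
  obtain ⟨A, rfl⟩ := (hJ H).1 (Submodule.mem_sup_left hH)
  -- As `𝔫` is orthogonal to `H`, the orthogonal complement of `H` in `𝔞 ⊕ 𝔫` is exactly `𝔰`.
  have hmem : ∀ b, q b A = 0 ↔ ∃ x, f x = b := by
    intro b
    rw [hf, hq]
    constructor
    · intro hb
      obtain ⟨X, hX, N, hN, hXN⟩ := Submodule.mem_sup.1 ((hJ _).2 ⟨b, rfl⟩)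
      refine ⟨X, ⟨hX, ?_⟩, N, hN, hXN⟩
      rw [← hXN, map_add, LinearMap.add_apply,
        h.apply_eq_zero_of_mem_sumWeightSpaces h𝔞 hab hH hN, add_zero] at hb
      exact hb
    · rintro ⟨X, ⟨-, hX⟩, N, hN, hXN⟩
      rw [← hXN, map_add, LinearMap.add_apply, hX,
        h.apply_eq_zero_of_mem_sumWeightSpaces h𝔞 hab hH hN, add_zero]
  -- `∇_H` acts as the bracket with the `𝔨`-part of `H`, which is zero.
  have hUA : ∀ y, U A y = 0 := by
    intro y
    by_contra hne
    have h1 := h.pPart_connection hq hqp hsurj hU A y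
    rw [kPart_eq_zero (h𝔞 _ hH), zero_lie] at h1
    have h2 := hqp _ hne
    rw [hq, ← h.apply_pPart, h1, map_zero] at h2
    exact lt_irrefl _ h2
  -- Brackets in `𝔞 ⊕ 𝔫` land in `𝔫`, hence are orthogonal to `H`: `ad H` preserves `𝔰`.
  obtain ⟨D, hD⟩ := exists_lieDerivation_of_lie_mem_range (f := f) hfi (A := A) (fun x ↦ by
    rw [← hmem, hq, LieHom.map_lie]
    exact h.apply_eq_zero_of_mem_sumWeightSpaces h𝔞 hab hH
      (lie_mem_of_mem_sup hP hab (finite_positiveRoots hab) ((hJ _).2 ⟨_, rfl⟩)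
        ((hJ _).2 ⟨_, rfl⟩)))
  refine ⟨-(2 * c)⁻¹, by rw [neg_lt_zero]; positivity,
    h.ricci_eq hq hqp hsurj hU he hc0.ne' hc, D, fun v ↦ by rw [hD, LieHom.map_lie], ?_⟩
  exact hU.ricci_codimension_one hV hs hqp hfi (by rw [hq, hHH]) hmem hUA (D := D.toLinearMap) hD
    hq' he' (fun b hb ↦ h.ricci_eq hq hqp hsurj hU hb hc0.ne' hc)

end IwasawaCodimensionOne

/-! ### Metrics of subgroups pulled back along an orbit. -/

section PulledBackMetric

variable {E : Type*} [NormedAddCommGroup E] [NormedSpace ℝ E]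
  {S : Type*} [TopologicalSpace S] [ChartedSpace E S] [Group S]
  [RiemannianBundle (fun x : S ↦ TangentSpace 𝓘(ℝ, E) x)]
  {E' : Type*} [NormedAddCommGroup E'] [NormedSpace ℝ E']
  {G : Type*} [TopologicalSpace G] [ChartedSpace E' G] [Group G]

/-- The metric of a Lie subgroup of `G` which is pulled back along an orbit. -/
lemma lieMetric_eq_orbitForm {F : Type*} [NormedAddCommGroup F] [NormedSpace ℝ F]
    {M : Type*} [TopologicalSpace M] [ChartedSpace F M] [MulAction G M]
    [RiemannianBundle (fun x : M ↦ TangentSpace 𝓘(ℝ, F) x)] {j : S →* G} {o : M}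
    (hp : ContMDiff 𝓘(ℝ, E') 𝓘(ℝ, F) ∞ (fun g : G ↦ g • o))
    (hj : ContMDiff 𝓘(ℝ, E) 𝓘(ℝ, E') ∞ j)
    (hS : IsIsometricImmersion (E := E) (E' := F) (fun s : S ↦ j s • o))
    (v w : GroupLieAlgebra 𝓘(ℝ, E) S) :
    lieMetric E S v w = orbitForm E' G F o (lieMap (E := E) (E' := E') j v)
      (lieMap (E := E) (E' := E') j w) := by
  have h1 := hS.metricAt_eq 1 v w
  have h2 := modelDeriv_comp (E := E) (E' := E') (E'' := F) (f := j) (g := fun g : G ↦ g • o)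
    (x := 1) (hp.mdifferentiable (by simp) _) (hj.mdifferentiable (by simp) _)
  rw [h2] at h1
  rw [orbitForm_eq_metricAt, lieMap_eq_modelDeriv, lieMap_eq_modelDeriv]
  simp only [map_one] at h1
  exact h1.symm

end PulledBackMetric

/-! ### Maximal abelian subspaces. -/

section MaximalAbelian

variable {E : Type*} [NormedAddCommGroup E] [NormedSpace ℝ E] [FiniteDimensional ℝ E]
  {G : Type*} [TopologicalSpace G] [ChartedSpace E G] [Group G] [LieGroup 𝓘(ℝ, E) ∞ G]
  {θ : GroupLieAlgebra 𝓘(ℝ, E) G →ₗ⁅ℝ⁆ GroupLieAlgebra 𝓘(ℝ, E) G}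
  {𝔞 : Submodule ℝ (GroupLieAlgebra 𝓘(ℝ, E) G)}

/-- Maximality is applied to the abelian subspace `𝔞 + ℝ X`. -/
lemma IsMaximalAbelian.mem_of_commute (h𝔞 : IsMaximalAbelian θ 𝔞) {X : GroupLieAlgebra 𝓘(ℝ, E) G} (hX : θ X = -X)
    (hc : ∀ A ∈ 𝔞, ⁅A, X⁆ = 0) : X ∈ 𝔞 := by
  have hX' : ∀ Y ∈ 𝔞 ⊔ Submodule.span ℝ {X}, ⁅Y, X⁆ = 0 := by
    intro Y hY
    obtain ⟨A, hA, Z, hZ, rfl⟩ := Submodule.mem_sup.1 hY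
    obtain ⟨t, rfl⟩ := Submodule.mem_span_singleton.1 hZ
    rw [add_lie, hc A hA, smul_lie, lie_self, smul_zero, add_zero]
  have := h𝔞.maximal (𝔞 ⊔ Submodule.span ℝ {X})
    (sup_le h𝔞.le ((Submodule.span_singleton_le_iff_mem _ _).2 hX)) (fun Y hY Z hZ ↦ by
      obtain ⟨A, hA, W, hW, rfl⟩ := Submodule.mem_sup.1 hY
      obtain ⟨t, rfl⟩ := Submodule.mem_span_singleton.1 hW
      obtain ⟨A', hA', W', hW', rfl⟩ := Submodule.mem_sup.1 hZ
      obtain ⟨t', rfl⟩ := Submodule.mem_span_singleton.1 hW'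
      rw [add_lie, lie_add, smul_lie, ← lie_skew X, hX' _ hZ, h𝔞.abelian A hA A' hA', lie_smul,
        hc A hA, smul_zero, neg_zero, smul_zero, add_zero, add_zero]) le_sup_left
  rw [← this]
  exact Submodule.mem_sup_right (Submodule.mem_span_singleton_self X)

end MaximalAbelian

/-! ### From Lie groups to metric Lie algebras. -/

section LieSubgroups

variable {E : Type*} [NormedAddCommGroup E] [NormedSpace ℝ E] [FiniteDimensional ℝ E]
  {S : Type*} [TopologicalSpace S] [ChartedSpace E S] [Group S] [LieGroup 𝓘(ℝ, E) ∞ S]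
  {E' : Type*} [NormedAddCommGroup E'] [NormedSpace ℝ E'] [FiniteDimensional ℝ E']
  {G : Type*} [TopologicalSpace G] [ChartedSpace E' G] [Group G] [LieGroup 𝓘(ℝ, E') ∞ G]

/-- The differential of a smooth homomorphism as a homomorphism of Lie algebras. -/
def lieMapHom (ι : S →* G) (hι : ContMDiff 𝓘(ℝ, E) 𝓘(ℝ, E') ∞ ι) :
    GroupLieAlgebra 𝓘(ℝ, E) S →ₗ⁅ℝ⁆ GroupLieAlgebra 𝓘(ℝ, E') G :=
  { lieMap (E := E) (E' := E') ι with
    map_lie' := fun {v w} ↦ lieMap_lie hι v w }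

variable [RiemannianBundle (fun x : S ↦ TangentSpace 𝓘(ℝ, E) x)]

lemma isOrthonormalBasis_lieBasis : IsOrthonormalBasis (lieMetric E S) (lieBasis E S) :=
  ⟨sum_lieMetric_smul_lieBasis⟩

lemma IsLeviCivita.isAlgebraicLeviCivita
    {nabla : CovariantDerivative 𝓘(ℝ, E) E (TangentSpace 𝓘(ℝ, E) : S → Type _)}
    (hn : IsLeviCivita nabla) (hS : IsLeftInvariantMetric E S) :
    IsAlgebraicLeviCivita (lieMetric E S) (leftCovariant nabla) :=
  ⟨hn.leftCovariant_sub, hn.lieMetric_leftCovariant hS⟩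

end LieSubgroups

/-! ### From the symmetric space to its Cartan form. -/

section SymmetricSpaceForm

variable {E : Type*} [NormedAddCommGroup E] [NormedSpace ℝ E] [FiniteDimensional ℝ E]
  {G : Type*} [TopologicalSpace G] [ChartedSpace E G] [Group G] [LieGroup 𝓘(ℝ, E) ∞ G]
  {F : Type*} [NormedAddCommGroup F] [NormedSpace ℝ F] [FiniteDimensional ℝ F]
  {M : Type*} [TopologicalSpace M] [ChartedSpace F M] [IsManifold 𝓘(ℝ, F) ∞ M]
  [RiemannianBundle (fun x : M ↦ TangentSpace 𝓘(ℝ, F) x)]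
  [IsContMDiffRiemannianBundle 𝓘(ℝ, F) ∞ F (fun x : M ↦ TangentSpace 𝓘(ℝ, F) x)]
  [MulAction G M] {o : M} {θ : GroupLieAlgebra 𝓘(ℝ, E) G →ₗ⁅ℝ⁆ GroupLieAlgebra 𝓘(ℝ, E) G}

theorem IsIrreducibleSymmetricSpace.isCartanForm
    (hM : IsIrreducibleSymmetricSpace (F := F) o θ) : IsCartanForm θ (orbitForm E G F o) where
  involutive := hM.involutive
  cartan := hM.cartan
  symm := orbitForm_comm o
  pos X hX := orbitForm_pos o X (fun h ↦ hX ((hM.isotropy X).2 h))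
  vertical X Y hX := orbitForm_eq_zero o X Y ((hM.isotropy X).1 hX)
  invariant Z X Y hZ :=
    orbitForm_lie_add_orbitForm_lie o hM.smooth hM.isometric ((hM.isotropy Z).1 hZ) X Y
  nontrivial := by
    obtain ⟨X, hX, h0⟩ := Submodule.exists_mem_ne_zero_of_ne_bot hM.nontrivial
    exact ⟨X, h0, hX⟩
  irreducible W hW hW' := by
    rcases hM.irreducible W hW hW' with h | h
    · exact Or.inl h
    · refine Or.inr fun X hX ↦ ?_
      rw [h]
      exact hX

end SymmetricSpaceForm

end

/-! ### The proposition. -/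

theorem proposition4p4
    {EG : Type*} [NormedAddCommGroup EG] [NormedSpace ℝ EG] [FiniteDimensional ℝ EG]
    {G : Type*} [TopologicalSpace G] [ChartedSpace EG G] [Group G] [LieGroup 𝓘(ℝ, EG) ∞ G]
    {EM : Type*} [NormedAddCommGroup EM] [NormedSpace ℝ EM] [FiniteDimensional ℝ EM]
    {M : Type*} [TopologicalSpace M] [ChartedSpace EM M] [IsManifold 𝓘(ℝ, EM) ∞ M]
    [RiemannianBundle (fun x : M ↦ TangentSpace 𝓘(ℝ, EM) x)]
    [IsContMDiffRiemannianBundle 𝓘(ℝ, EM) ∞ EM (fun x : M ↦ TangentSpace 𝓘(ℝ, EM) x)]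
    [MulAction G M]
    -- `M` is an irreducible symmetric space of non-compact type, `M = G / K`, `o = eK`
    (o : M) (θ : GroupLieAlgebra 𝓘(ℝ, EG) G →ₗ⁅ℝ⁆ GroupLieAlgebra 𝓘(ℝ, EG) G)
    (hM : IsIrreducibleSymmetricSpace (F := EM) o θ)
    -- data of an Iwasawa decomposition of `𝔤`
    (𝔞 : Submodule ℝ (GroupLieAlgebra 𝓘(ℝ, EG) G)) (h𝔞 : IsMaximalAbelian θ 𝔞)
    (P : Set (Module.Dual ℝ 𝔞)) (hP : IsPositivity P)
    -- the connected Lie subgroup `AN` of `G` with Lie algebra `𝔞 ⊕ 𝔫`; its metric is pulled back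
    -- from `M`
    {EA : Type*} [NormedAddCommGroup EA] [NormedSpace ℝ EA] [FiniteDimensional ℝ EA]
    {AN : Type*} [TopologicalSpace AN] [ChartedSpace EA AN] [Group AN] [LieGroup 𝓘(ℝ, EA) ∞ AN]
    [RiemannianBundle (fun x : AN ↦ TangentSpace 𝓘(ℝ, EA) x)]
    (j : AN →* G) (hj : IsConnectedLieSubgroup (E := EA) (E' := EG) j (𝔞 ⊔ nilpotentPart 𝔞 P))
    (hAN : IsIsometricImmersion (E := EA) (E' := EM) (fun h : AN ↦ j h • o))
    (nablaAN : CovariantDerivative 𝓘(ℝ, EA) EA (TangentSpace 𝓘(ℝ, EA) : AN → Type _))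
    (hnablaAN : IsLeviCivita nablaAN)
    -- the unit vector `H ∈ 𝔞`
    (H : GroupLieAlgebra 𝓘(ℝ, EG) G) (hH : H ∈ 𝔞) (hH_unit : orbitInner (F := EM) o H H = 1)
    -- the connected Lie subgroup `S` of `AN` with Lie algebra `(𝔞 ⊖ ℝ H) ⊕ 𝔫`, with the metric
    -- induced from `AN`
    {ES : Type*} [NormedAddCommGroup ES] [NormedSpace ℝ ES] [FiniteDimensional ℝ ES]
    {S : Type*} [TopologicalSpace S] [ChartedSpace ES S] [Group S] [LieGroup 𝓘(ℝ, ES) ∞ S]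
    [RiemannianBundle (fun x : S ↦ TangentSpace 𝓘(ℝ, ES) x)]
    (ι : S →* AN)
    (hι : IsConnectedLieSubgroup (E := ES) (E' := EA) ι
      ((orthogonalIn (F := EM) o 𝔞 H ⊔ nilpotentPart 𝔞 P).comap (lieMap (E := EA) (E' := EG) j)))
    (hS : IsIsometricImmersion (E := ES) (E' := EA) ι)
    (nablaS : CovariantDerivative 𝓘(ℝ, ES) ES (TangentSpace 𝓘(ℝ, ES) : S → Type _))
    (hnablaS : IsLeviCivita nablaS) :
    IsSolvsoliton nablaS ∧
    ∃ k : ℝ, k < 0 ∧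
      -- `M ≅ AN` is Einstein with Einstein constant `k`
      (∀ v : GroupLieAlgebra 𝓘(ℝ, EA) AN, ricciOperator nablaAN v = k • v) ∧
      -- `Ric = k Id + tr(ad H) ad H` on the Lie algebra of `S`, on which `ad H` is a derivation
      ∃ adH : LieDerivation ℝ (GroupLieAlgebra 𝓘(ℝ, ES) S) (GroupLieAlgebra 𝓘(ℝ, ES) S),
        (∀ v : GroupLieAlgebra 𝓘(ℝ, ES) S,
          lieMap (E := EA) (E' := EG) j (lieMap (E := ES) (E' := EA) ι (adH v)) =
            ⁅H, lieMap (E := EA) (E' := EG) j (lieMap (E := ES) (E' := EA) ι v)⁆) ∧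
        ∀ v : GroupLieAlgebra 𝓘(ℝ, ES) S, ricciOperator nablaS v =
          k • v + LinearMap.trace ℝ (GroupLieAlgebra 𝓘(ℝ, ES) S) adH.toLinearMap • adH v := by
  have hsm := hM.smooth
  have h := hM.isCartanForm
  have hp : ContMDiff 𝓘(ℝ, EG) 𝓘(ℝ, EM) ∞ (fun g : G ↦ g • o) :=
    (contMDiff_id (I := 𝓘(ℝ, EG)) (M := G)).smul contMDiff_const
  have hAN' : IsLeftInvariantMetric EA AN :=
    IsLeftInvariantMetric.of_equivariant hAN (Φ := fun g x ↦ j g • x) (fun g ↦ hM.isometric (j g))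
      (fun g x ↦ by rw [map_mul, mul_smul])
  have hS' : IsLeftInvariantMetric ES S := .of_monoidHom hAN' hS
  have hab := h𝔞.abelian
  -- `sumWeightSpaces 𝔞 (positiveRoots 𝔞 P)` unfolds to the same subspace as `nilpotentPart 𝔞 P`.
  have hJ : ∀ X, X ∈ 𝔞 ⊔ sumWeightSpaces 𝔞 (positiveRoots 𝔞 P) ↔
      ∃ b, lieMapHom j hj.contMDiff b = X := fun X ↦
    (SetLike.ext_iff.1 hj.range_lieMap X).symm
  have hf : ∀ b, (∃ x, lieMapHom ι hι.contMDiff x = b) ↔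
      ∃ X, (X ∈ 𝔞 ∧ orbitForm EG G EM o X H = 0) ∧
        ∃ N ∈ sumWeightSpaces 𝔞 (positiveRoots 𝔞 P), X + N = lieMapHom j hj.contMDiff b := by
    intro b
    have h1 : (∃ x, lieMapHom ι hι.contMDiff x = b) ↔
        b ∈ LinearMap.range (lieMap (E := ES) (E' := EA) ι) := Iff.rfl
    rw [h1, hι.range_lieMap, Submodule.mem_comap, Submodule.mem_sup]
    exact Iff.rfl
  obtain ⟨k, hk, hRic, D, hD, hRic'⟩ := h.exists_ricci_codimension_one hP (fun X hX ↦ h𝔞.le hX) hab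
    (fun X hX hc ↦ h𝔞.mem_of_commute hX hc) hJ (lieMetric_eq_orbitForm hp hj.contMDiff hAN)
    lieMetric_pos (hnablaAN.isAlgebraicLeviCivita hAN') hH hH_unit hι.injective_lieMap hf
    (fun x y ↦ (lieMetric_lieMap hS x y).symm) (hnablaS.isAlgebraicLeviCivita hS')
    isOrthonormalBasis_lieBasis isOrthonormalBasis_lieBasis
  have hRicS : ∀ v : GroupLieAlgebra 𝓘(ℝ, ES) S, ricciOperator nablaS v =
      k • v + LinearMap.trace ℝ (GroupLieAlgebra 𝓘(ℝ, ES) S) D.toLinearMap • D v := fun v ↦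
    (hnablaS.ricciOperator_eq hS' v).trans (hRic' v)
  refine ⟨⟨?_, k, LinearMap.trace ℝ (GroupLieAlgebra 𝓘(ℝ, ES) S) D.toLinearMap • D, hRicS⟩,
    k, hk, fun v ↦ (hnablaAN.ricciOperator_eq hAN' v).trans (hRic v), D, hD, hRicS⟩
  exact isSolvable_of_mem_sup hP hab
    ((lieMapHom j hj.contMDiff).comp (lieMapHom ι hι.contMDiff))
    (hj.injective_lieMap.comp hι.injective_lieMap) (fun x ↦ (hJ _).2 ⟨_, rfl⟩)
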